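/- **Theorem 1.2.** A partition of $\{1,\dots,n\}$ is called *planar* if there are no $a<b<c<d$ with $a,c$ in one part and $b,d$ in another part. If $\tau$ is nonplanar, pick such $a<b<c<d$, subdivide the part containing $a,c$ arbitrarily into $A\ni a$ and $C\ni c$, subdivide the part containing $b,d$ arbitrarily into $B\ni b$ and $D\ni d$, and let "rest" be the remaining parts. *Rule 1* is the replacement, in formal integer linear combinations of partitions, $$AC|BD|\mathrm{rest}\;\to\;A|BCD|\mathrm{rest}+B|ACD|\mathrm{rest}+C|ABD|\mathrm{rest}+D|ABC|\mathrm{rest}-AB|CD|\mathrm{rest}-AD|BC|\mathrm{rest}.$$ Let $\mathcal G$ be a finite graph (parallel edges and loops allowed) with positive edge weights and distinct vertices numbered $1,\dots,n$, the *nodes*, such that every connected component of $\mathcal G$ contains a node. A *grove* is a spanning forest of $\mathcal G$ each of whose component trees contains a node; a random grove is chosen with probability proportional to the product of its edge weights, and $\Pr(\tau)$ is the probability that its components partition the nodes according to $\tau$. Viewing edge weights as conductances, let $L_{i,j}$ ($i\ne j$) be the current that flows out of the network at node $j$ when node $i$ is held at one volt and the other nodes at zero volts, i.e. $L_{i,j}=-\Lambda_{i,j}$,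 where $\Lambda$ is the Schur complement, in the weighted Laplacian of $\mathcal G$, of its block indexed by the non-node vertices. Put $L_\tau=\sum_F\prod_{\{i,j\}\in F}L_{i,j}$, the sum over the spanning forests $F$ of the complete graph on $\{1,\dots,n\}$ whose trees span the parts of $\tau$. The graph is *circular planar* if it can be drawn in the closed unit disk without crossings so that the nodes $1,\dots,n$ lie on the boundary circle in counterclockwise order. Then any partition $\tau$ of $\{1,\dots,n\}$ can be transformed into a formal integer linear combination of planar partitions by repeated application of Rule 1, and the resulting combination of planar partitions does not depend on the choices made when applying Rule 1, so that we may write $$\tau\to\sum_{\sigma\text{ planar}}\mathcal P^{(t)}_{\sigma,\tau}\,\sigma .$$ The coefficients $\mathcal P^{(t)}_{\sigma,\tau}\in\mathbb Z$, which depend only on $\sigma$ and $\tau$, satisfy, for every planar partition $\sigma$, $$\frac{\Pr(\sigma)}{\Pr(1|2|\cdots|n)}=\sum_{\tau}\mathcal P^{(t)}_{\sigma,\tau}L_\tau$$ for every circular planar $\mathcal G$, and, for every $\mathcal G$ (planar or not), $$\sum_{\tau}\mathcal P^{(t)}_{\sigma,\tau}\frac{\Pr(\tau)}{\Pr(1|2|\cdots|n)}=\sum_{\tau}\mathcal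 P^{(t)}_{\sigma,\tau}L_\tau ,$$ the sums being over all partitions $\tau$ of $\{1,\dots,n\}$. -/

import Mathlib

universe u v

/-! ## Set partitions, planar partitions, formal linear combinations, Rule 1

The nodes `1, …, n` are represented by `Fin n`, with its usual order. -/

/-- Partitions of the set of `n` nodes into nonempty parts. The bottom element `⊥` is the partition
`1|2|⋯|n` into singletons. -/
abbrev SetPartition (n : ℕ) : Type := Finpartition (Finset.univ : Finset (Fin n))

/-- Items `i` and `j` lie in one part of `τ`. -/
def SamePart {n : ℕ} (τ : SetPartition n) (i j : Fin n) : Prop :=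
  ∃ p ∈ τ.parts, i ∈ p ∧ j ∈ p

/-- `τ` is planar (noncrossing): there are no items `a < b < c < d` with `a`, `c` in one part and
`b`, `d` in another part. -/
def IsPlanarPartition {n : ℕ} (τ : SetPartition n) : Prop :=
  ∀ p ∈ τ.parts, ∀ q ∈ τ.parts, p ≠ q →
    ¬ ∃ a b c d : Fin n, a < b ∧ b < c ∧ c < d ∧ a ∈ p ∧ c ∈ p ∧ b ∈ q ∧ d ∈ q

/-- The planar partitions of `n` nodes. -/
abbrev PlanarPartition (n : ℕ) : Type := {σ : SetPartition n // IsPlanarPartition σ}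

noncomputable instance (n : ℕ) : Fintype (PlanarPartition n) := Fintype.ofFinite _

/-- Formal integer linear combinations of partitions of `n` nodes. -/
abbrev PartitionComb (n : ℕ) : Type := SetPartition n →₀ ℤ

/-- The formal linear combination `∑ c_σ σ` over planar partitions `σ`. -/
noncomputable def planarComb {n : ℕ} (c : PlanarPartition n → ℤ) : PartitionComb n :=
  ∑ σ : PlanarPartition n, Finsupp.single σ.1 (c σ)

/-- `r` is the right-hand side of an instance of the rule
`AC|BD|rest → A|BCD|rest + B|ACD|rest + C|ABD|rest + D|ABC|rest - AB|CD|rest - AD|BC|rest`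
whose left-hand side is `τ`: there are items `a < b < c < d` with `a ∈ A`, `b ∈ B`, `c ∈ C`,
`d ∈ D`, and `A ∪ C`, `B ∪ D` are two different parts of `τ`, subdivided arbitrarily. -/
def Rule1 {n : ℕ} (τ : SetPartition n) (r : PartitionComb n) : Prop :=
  ∃ (A B C D : Finset (Fin n)) (a b c d : Fin n),
    a < b ∧ b < c ∧ c < d ∧ a ∈ A ∧ b ∈ B ∧ c ∈ C ∧ d ∈ D ∧
    Disjoint A C ∧ Disjoint B D ∧ A ∪ C ∈ τ.parts ∧ B ∪ D ∈ τ.parts ∧ A ∪ C ≠ B ∪ D ∧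
    ∃ ρA ρB ρC ρD ρAB ρAD : SetPartition n,
      ρA.parts = {A, B ∪ C ∪ D} ∪ (τ.parts \ {A ∪ C, B ∪ D}) ∧
      ρB.parts = {B, A ∪ C ∪ D} ∪ (τ.parts \ {A ∪ C, B ∪ D}) ∧
      ρC.parts = {C, A ∪ B ∪ D} ∪ (τ.parts \ {A ∪ C, B ∪ D}) ∧
      ρD.parts = {D, A ∪ B ∪ C} ∪ (τ.parts \ {A ∪ C, B ∪ D}) ∧
      ρAB.parts = {A ∪ B, C ∪ D} ∪ (τ.parts \ {A ∪ C, B ∪ D}) ∧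
      ρAD.parts = {A ∪ D, B ∪ C} ∪ (τ.parts \ {A ∪ C, B ∪ D}) ∧
      r = Finsupp.single ρA 1 + Finsupp.single ρB 1 + Finsupp.single ρC 1 + Finsupp.single ρD 1
        - Finsupp.single ρAB 1 - Finsupp.single ρAD 1

/-- One application of Rule 1 to a linear combination: a partition `τ` that occurs in `x` is
replaced, with its whole coefficient, by the right-hand side of an instance of the rule. -/
def Rule1Step {n : ℕ} (x y : PartitionComb n) : Prop :=
  ∃ (τ : SetPartition n) (r : PartitionComb n), Rule1 τ r ∧ x τ ≠ 0 ∧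
    y = x + x τ • (r - Finsupp.single τ 1)

/-- The most liberal reading of one application of Rule 1: like terms need not be collected, and
only some of the copies of `τ` are replaced, so that different copies may be treated with different
choices. -/
def Rule1StepCopies {n : ℕ} (x y : PartitionComb n) : Prop :=
  ∃ (τ : SetPartition n) (r : PartitionComb n) (k : ℤ), Rule1 τ r ∧
    y = x + k • (r - Finsupp.single τ 1)

open Classical in
/-- `L_τ = ∑_F ∏_{{i,j} ∈ F} L_{i,j}`, summed over the spanning forests `F` of the complete graph on
the `n` nodes whose trees span the parts of `τ`. An edge `{i,j}` is listed once, with `i < j`. -/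
noncomputable def forestPoly {n : ℕ} (L : Matrix (Fin n) (Fin n) ℝ) (τ : SetPartition n) : ℝ :=
  ∑ F ∈ (Finset.univ : Finset (SimpleGraph (Fin n))).filter
      (fun F => F.IsAcyclic ∧ ∀ i j, F.Reachable i j ↔ SamePart τ i j),
    ∏ e ∈ (Finset.univ : Finset (Fin n × Fin n)).filter (fun e => e.1 < e.2 ∧ F.Adj e.1 e.2),
      L e.1 e.2

/-! ## Weighted graphs with nodes, groves, the response matrix -/

/-- A weighted graph (parallel edges and loops allowed) with vertex set `V`, edge set `E`, positive
edge weights (conductances), and `n` distinct numbered vertices, the nodes. -/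
structure NodedGraph (V E : Type*) (n : ℕ) where
  /-- The unordered pair of endpoints of an edge. -/
  ends : E → Sym2 V
  /-- The weight (conductance) of an edge. -/
  weight : E → ℝ
  weight_pos : ∀ e, 0 < weight e
  /-- The `i`-th node. -/
  node : Fin n → V
  node_injective : Function.Injective node

namespace NodedGraph

variable {V E : Type*} {n : ℕ} (G : NodedGraph V E n)

/-- Two vertices are connected by a path that uses edges of `F` only. -/
def Connects (F : Set E) (u v : V) : Prop :=
  Relation.ReflTransGen (fun x y => ∃ e ∈ F, G.ends e = s(x, y)) u v

/-- The spanning subgraph with edge set `F` has no cycle: the endpoints of an edge of `F` are not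
connected by the other edges of `F`. -/
def IsForest (F : Set E) : Prop :=
  ∀ e ∈ F, ∀ u v, G.ends e = s(u, v) → ¬ G.Connects (F \ {e}) u v

/-- A grove: a spanning forest each of whose component trees contains at least one node. -/
def IsGrove (F : Set E) : Prop :=
  G.IsForest F ∧ ∀ v, ∃ i, G.Connects F v (G.node i)

/-- The components of `F` partition the nodes according to `τ`. -/
def HasType (F : Set E) (τ : SetPartition n) : Prop :=
  ∀ i j, G.Connects F (G.node i) (G.node j) ↔ SamePart τ i j

/-- Every connected component of the graph contains a node. -/
def EveryComponentHasNode : Prop :=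
  ∀ v, ∃ i, G.Connects Set.univ v (G.node i)

variable [Fintype V] [Fintype E]

/-- The weight of a spanning subgraph, the product of its edge weights. -/
noncomputable def subgraphWeight (F : Finset E) : ℝ := ∏ e ∈ F, G.weight e

open Classical in
/-- The weighted sum of all groves. -/
noncomputable def groveSum : ℝ :=
  ∑ F ∈ (Finset.univ : Finset (Finset E)).filter (fun F : Finset E => G.IsGrove (F : Set E)),
    G.subgraphWeight F

open Classical in
/-- The weighted sum of the groves of type `τ`. -/
noncomputable def groveSumOfType (τ : SetPartition n) : ℝ :=
  ∑ F ∈ (Finset.univ : Finset (Finset E)).filter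
      (fun F : Finset E => G.IsGrove (F : Set E) ∧ G.HasType (F : Set E) τ),
    G.subgraphWeight F

/-- `Pr(τ)`: the probability that a random grove, chosen with probability proportional to its
weight, partitions the nodes according to `τ`. -/
noncomputable def Pr (τ : SetPartition n) : ℝ := G.groveSumOfType τ / G.groveSum

open Classical in
/-- The total conductance `c_{u,v}` of the edges that join `u` and `v`. -/
noncomputable def conductance (u v : V) : ℝ :=
  ∑ e ∈ (Finset.univ : Finset E).filter (fun e => G.ends e = s(u, v)), G.weight e

open Classical in
/-- The matrix of the Laplacian `Δ f (v) = ∑_w c_{v,w} (f v - f w)`. -/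
noncomputable def laplacian : Matrix V V ℝ :=
  fun u v => (if u = v then ∑ w, G.conductance u w else 0) - G.conductance u v

/-- The inner vertices: those which are not nodes. -/
abbrev Inner : Type _ := {v : V // v ∉ Set.range G.node}

noncomputable instance : Fintype G.Inner := Fintype.ofFinite _

open Classical in
/-- The response (Dirichlet-to-Neumann) matrix `Λ = F - G K⁻¹ H`, the Schur complement of the block
`K` of the Laplacian `(F, G; H, K)` that is indexed by the inner vertices. The block `K` is
invertible when every component of the graph contains a node. -/
noncomputable def responseMatrix : Matrix (Fin n) (Fin n) ℝ :=
  G.laplacian.submatrix G.node G.node -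
    G.laplacian.submatrix G.node (Subtype.val : G.Inner → V) *
      (G.laplacian.submatrix (Subtype.val : G.Inner → V) (Subtype.val : G.Inner → V))⁻¹ *
      G.laplacian.submatrix (Subtype.val : G.Inner → V) G.node

/-- `L_{i,j} = -Λ_{i,j}`; for `i ≠ j` this is the current that flows out of the network at node `j`
when node `i` is held at one volt and the other nodes at zero volts. -/
noncomputable def L : Matrix (Fin n) (Fin n) ℝ := - G.responseMatrix

end NodedGraph

/-! ## Circular planar graphs -/

/-- A drawing of the graph in the closed unit disk without crossings, in which the nodes lie on the
boundary circle, in counterclockwise order. -/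
structure DiskDrawing {V E : Type*} {n : ℕ} (G : NodedGraph V E n) where
  /-- The positions of the vertices. -/
  pos : V → ℂ
  pos_injective : Function.Injective pos
  pos_mem_disk : ∀ v, ‖pos v‖ ≤ 1
  /-- The curves that represent the edges, parametrized by `[0, 1]`. -/
  arc : E → ℝ → ℂ
  arc_continuousOn : ∀ e, ContinuousOn (arc e) (Set.Icc 0 1)
  arc_mem_disk : ∀ e, ∀ t ∈ Set.Icc (0 : ℝ) 1, ‖arc e t‖ ≤ 1
  /-- A curve joins the positions of the endpoints of its edge. -/
  arc_ends : ∀ e, s(arc e 0, arc e 1) = (G.ends e).map pos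
  /-- A curve does not cross itself. -/
  arc_injOn : ∀ e, Set.InjOn (arc e) (Set.Ioo 0 1)
  /-- A curve passes through no vertex between its ends. -/
  arc_ne_pos : ∀ e, ∀ t ∈ Set.Ioo (0 : ℝ) 1, ∀ v, arc e t ≠ pos v
  /-- Different curves do not meet between their ends. -/
  arc_ne_arc : ∀ e e', e ≠ e' → ∀ t ∈ Set.Ioo (0 : ℝ) 1, ∀ t' ∈ Set.Ioo (0 : ℝ) 1,
    arc e t ≠ arc e' t'
  /-- The angles at which the nodes are placed. -/
  angle : Fin n → ℝ
  angle_strictMono : StrictMono angle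
  angle_lt : ∀ i j, angle i < angle j + 2 * Real.pi
  pos_node : ∀ i, pos (G.node i) = Complex.exp (angle i * Complex.I)

/-- `G` is circular planar: a planar graph whose nodes lie on the outer face, numbered in
counterclockwise order. -/
def IsCircularPlanar {V E : Type*} {n : ℕ} (G : NodedGraph V E n) : Prop :=
  Nonempty (DiskDrawing G)

/-! The proof tests partitions against determinants. For a real matrix `T` on the nodes, not
necessarily symmetric, let `gramDet T τ.parts` be the determinant of `T` after its rows and columns
have been summed over the parts of `τ`. Extended linearly, these functionals link Rule 1 to groves.

Rule 1: the seven partitions in an instance differ only in how the union of two parts is split as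
X|Y. Adding row and column X to row and column Y replaces the second indicator by that of the whole
union, so the determinant is a quadratic form in X whose bilinear form vanishes when either argument
is the whole union. The rule is an identity for such forms (`mixedDet_rule`), so every functional is
invariant (`isRuleInvariant_gramDet`).

Uniqueness: the functionals separate combinations of planar partitions
(`eq_zero_of_sum_gramDet_eq_zero`). Testing with the 0-1 matrix that marks the smallest and largest
item of each part of `σ` gives a triangular system, because a planar partition is determined by the
sets of minima and maxima of its parts (`planar_ext`). Existence: the subdivision can be chosen so
that all six replacements decrease a lexicographic measure (`exists_smallerMove`).

Groves: let K be the inner block of the Laplacian Δ. A matrix-forest expansion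
(`det_add_compress_node`) shows that det(Δ + T), with T placed on the nodes, is the sum over `τ` of
the grove sum of `τ` times `gramDet T τ.parts`. A Schur complement turns this determinant into det K
· det(Λ + T), and Λ is itself the Laplacian of a complete graph on the nodes with weights `L`. Hence
grove sums and det K times forest polynomials agree against every functional, so they have the same
image under the reduction to planar partitions. The coefficient at the singletons identifies det K
with the grove sum of `⊥`, and division gives the identity for arbitrary graphs.

Circular planar graphs: disjoint connected sets in a disk cannot join interleaved boundary points
(`not_disjoint_of_joinedIn`), so nonplanar partitions have probability zero and only the term of `σ`
survives on the left. -/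

/-! ## Compressing a matrix along a map -/

namespace Matrix

section Compress

set_option linter.unusedSectionVars false

variable {V K J : Type*} [Fintype V] [Fintype K] [Fintype J]
  [DecidableEq V] [DecidableEq K] [DecidableEq J]

/-- The incidence matrix of the fibres of a map. -/
def fiberMatrix {V K : Type*} [DecidableEq K] (f : V → K) : Matrix V K ℝ :=
  of fun v k => if f v = k then 1 else 0

/-- The matrix obtained from `S` by adding up the rows and the columns in each fibre of `f`. -/
def compress (f : V → K) (S : Matrix V V ℝ) : Matrix K K ℝ :=
  (fiberMatrix f)ᵀ * S * fiberMatrix f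

theorem fiberMatrix_comp (f : V → K) (g : K → J) :
    fiberMatrix (g ∘ f) = fiberMatrix f * fiberMatrix g := by
  ext v j
  rw [mul_apply, Finset.sum_eq_single (f v)]
  · simp [fiberMatrix]
  · intro k _ hk
    simp [fiberMatrix, hk.symm]
  · simp

theorem compress_comp (f : V → K) (g : K → J) (S : Matrix V V ℝ) :
    compress (g ∘ f) S = compress g (compress f S) := by
  simp only [compress, fiberMatrix_comp, transpose_mul, Matrix.mul_assoc]

theorem compress_apply (f : V → K) (S : Matrix V V ℝ) (p q : K) :
    compress f S p q = ∑ u, ∑ v, if f u = p ∧ f v = q then S u v else 0 := by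
  simp only [compress, fiberMatrix, mul_apply, transpose_apply, of_apply, Finset.sum_mul]
  rw [Finset.sum_comm]
  refine Finset.sum_congr rfl fun u _ => Finset.sum_congr rfl fun v _ => ?_
  by_cases h1 : f u = p <;> by_cases h2 : f v = q <;> simp [h1, h2]

theorem compress_add (f : V → K) (S T : Matrix V V ℝ) :
    compress f (S + T) = compress f S + compress f T := by
  simp [compress, Matrix.mul_add, Matrix.add_mul]

theorem compress_smul (f : V → K) (w : ℝ) (S : Matrix V V ℝ) :
    compress f (w • S) = w • compress f S := by
  simp [compress]

theorem compress_id (S : Matrix V V ℝ) : compress id S = S := by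
  have : fiberMatrix (id : V → V) = 1 := by
    ext i j
    simp [fiberMatrix, one_apply]
  simp [compress, this]

/-- The matrix of the quadratic form `(x u - x v)²`. -/
def edgeMatrix (u v : V) : Matrix V V ℝ :=
  vecMulVec (Pi.single u 1 - Pi.single v 1) (Pi.single u 1 - Pi.single v 1)

theorem edgeMatrix_comm (u v : V) : edgeMatrix u v = edgeMatrix v u := by
  rw [edgeMatrix, edgeMatrix, ← neg_sub (Pi.single v (1 : ℝ) : V → ℝ), vecMulVec_neg,
    neg_vecMulVec, neg_neg]

@[simp] theorem edgeMatrix_self (u : V) : edgeMatrix u u = 0 := by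
  simp [edgeMatrix]

theorem compress_edgeMatrix (f : V → K) (u v : V) :
    compress f (edgeMatrix u v) = edgeMatrix (f u) (f v) := by
  have h : ∀ u, (fiberMatrix f)ᵀ *ᵥ Pi.single u (1 : ℝ) = Pi.single (f u) 1 := by
    intro u
    ext k
    simp [fiberMatrix, Pi.single_apply, eq_comm]
  rw [edgeMatrix, compress, mul_vecMulVec, vecMulVec_mul, ← mulVec_transpose, mulVec_sub, h, h,
    edgeMatrix]

/-- The determinant of a compression depends on the fibres of the map only. -/
theorem det_compress_congr (f : V → K) (g : V → J) (hf : Function.Surjective f)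
    (hg : Function.Surjective g) (h : ∀ u v, f u = f v ↔ g u = g v) (S : Matrix V V ℝ) :
    (compress f S).det = (compress g S).det := by
  choose s hs using hf
  choose t ht using hg
  let e : K ≃ J :=
    { toFun := fun k => g (s k)
      invFun := fun j => f (t j)
      left_inv := fun k => by
        rw [← hs k, h, ht, hs]
      right_inv := fun j => by
        rw [← ht j, ← h, hs, ht] }
  rw [← det_submatrix_equiv_self e (compress g S)]
  congr 1
  ext p q
  rw [submatrix_apply, compress_apply, compress_apply]
  have key : ∀ u p, f u = p ↔ g u = e p := fun u p => by
    rw [← hs p, h, hs]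
    rfl
  simp only [key]

theorem det_compress_eq_zero (f : V → K) (hf : ¬ Function.Surjective f)
    (S : Matrix V V ℝ) : (compress f S).det = 0 := by
  simp only [Function.Surjective, not_forall, not_exists] at hf
  obtain ⟨k, hk⟩ := hf
  refine det_eq_zero_of_row_eq_zero k fun j => ?_
  simp [compress_apply, hk]

/-- Merging two indices. -/
def mergeMap (k l : K) (hkl : k ≠ l) (x : K) : {x : K // x ≠ l} :=
  if h : x = l then ⟨k, hkl⟩ else ⟨x, h⟩

theorem mergeMap_surjective (k l : K) (hkl : k ≠ l) : Function.Surjective (mergeMap k l hkl) :=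
  fun x => ⟨x, by simp [mergeMap, x.2]⟩

theorem mergeMap_eq_iff (k l : K) (hkl : k ≠ l) (x y : K) :
    mergeMap k l hkl x = mergeMap k l hkl y ↔
      x = y ∨ (x = k ∧ y = l) ∨ (x = l ∧ y = k) := by
  unfold mergeMap
  split_ifs with h1 h2 h2 <;> simp [Subtype.ext_iff] <;> grind

/-- Deletion-contraction for determinants. A congruence of determinant one turns the rank-one update
into a change of the single entry (l, l), whose cofactor is `M` with `k` and `l` merged. -/
theorem det_add_edgeMatrix (k l : K) (hkl : k ≠ l) (w : ℝ) (M : Matrix K K ℝ) :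
    (M + w • edgeMatrix k l).det = M.det + w * (compress (mergeMap k l hkl) M).det := by
  -- add row `l` to row `k` and column `l` to column `k`
  have htr : ∀ A : Matrix K K ℝ,
      (transvection k l 1 * A * (transvection k l 1)ᵀ).det = A.det := by
    intro A
    simp [det_mul, det_transpose, det_transvection_of_ne k l hkl]
  set U : Matrix K K ℝ := transvection k l 1 with hU
  have hUb : U *ᵥ (Pi.single k 1 - Pi.single l 1) = - Pi.single l (1 : ℝ) := by
    rw [hU, transvection, add_mulVec, mulVec_sub, mulVec_sub]
    ext i
    have h1 : (1 : Matrix K K ℝ) i k = if i = k then 1 else 0 := one_apply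
    have h2 : (1 : Matrix K K ℝ) i l = if i = l then 1 else 0 := one_apply
    simp [Pi.single_apply, single_apply, h1, h2]
    grind
  have hE : U * (w • edgeMatrix k l) * Uᵀ = w • vecMulVec (Pi.single l 1) (Pi.single l 1) := by
    rw [edgeMatrix, Matrix.mul_smul, mul_vecMulVec, Matrix.smul_mul, vecMulVec_mul,
      vecMul_transpose, hUb, neg_vecMulVec, vecMulVec_neg, neg_neg]
  rw [← htr (M + w • edgeMatrix k l), ← htr M, Matrix.mul_add, Matrix.add_mul, hE]
  set A := U * M * Uᵀ with hA
  -- The update sits in row `l` alone, so the determinant is affine in it.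
  have hrow : A + w • vecMulVec (Pi.single l 1) (Pi.single l 1) =
      A.updateRow l (A l + w • Pi.single l 1) := by
    ext i j
    by_cases hi : i = l
    · subst hi; simp [vecMulVec_apply]
    · simp [vecMulVec_apply, hi]
  rw [hrow, det_updateRow_add, updateRow_eq_self, det_updateRow_smul]
  congr 2
  -- Away from row `l`, `U` is the transposed incidence matrix of the merging map; so deleting row
  -- and column `l` of `A` leaves the compression of `M`.
  have hUf : ∀ (i : {x // x ≠ l}) (u : K), U i u = fiberMatrix (mergeMap k l hkl) u i := by
    rintro ⟨i, hi⟩ u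
    have h1 : (1 : Matrix K K ℝ) i u = if i = u then 1 else 0 := one_apply
    simp [hU, transvection, fiberMatrix, mergeMap, single_apply, h1, Subtype.ext_iff]
    by_cases h2 : u = l <;> grind
  have hblock : toSquareBlockProp (A.updateRow l (Pi.single l 1)) (fun x => x ≠ l) =
      compress (mergeMap k l hkl) M := by
    ext i j
    simp only [toSquareBlockProp, toBlock_apply, updateRow_ne i.2, compress, hA, mul_apply,
      transpose_apply, hUf]
  have hone : (toSquareBlockProp (A.updateRow l (Pi.single l 1)) fun x => ¬ x ≠ l) = 1 := by
    ext ⟨i, hi⟩ ⟨j, hj⟩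
    rw [not_not] at hi hj
    subst hi; subst hj
    simp [toSquareBlockProp]
  rw [twoBlockTriangular_det _ (fun x => x ≠ l), hblock, hone, det_one, mul_one]
  intro i hi j hj
  rw [not_not] at hi
  subst hi
  simp [hj]

end Compress

end Matrix

/-! ## The all-minors matrix-forest theorem -/

section EdgeForest

open Matrix

set_option linter.unusedSectionVars false

variable {V E : Type*} (ends : E → Sym2 V)

/-- Two vertices are connected by a path that uses edges of `F` only. -/
def EdgeConnects (F : Set E) (u v : V) : Prop :=
  Relation.ReflTransGen (fun x y => ∃ e ∈ F, ends e = s(x, y)) u v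

/-- The edges of `F` form no cycle. -/
def IsEdgeForest (F : Set E) : Prop :=
  ∀ e ∈ F, ∀ u v, ends e = s(u, v) → ¬ EdgeConnects ends (F \ {e}) u v

variable {ends}

theorem EdgeConnects.symm {F : Set E} {u v : V} (h : EdgeConnects ends F u v) :
    EdgeConnects ends F v u := by
  induction h with
  | refl => exact .refl
  | tail _ h ih =>
    obtain ⟨e, he, h⟩ := h
    exact .head ⟨e, he, h.trans Sym2.eq_swap⟩ ih

theorem EdgeConnects.refl (F : Set E) (u : V) : EdgeConnects ends F u u :=
  Relation.ReflTransGen.refl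

theorem EdgeConnects.trans {F : Set E} {u v w : V} (h : EdgeConnects ends F u v)
    (h' : EdgeConnects ends F v w) : EdgeConnects ends F u w :=
  Relation.ReflTransGen.trans h h'

theorem EdgeConnects.mono {F F' : Set E} (hF : F ⊆ F') {u v : V} (h : EdgeConnects ends F u v) :
    EdgeConnects ends F' u v :=
  Relation.ReflTransGen.mono (fun _ _ ⟨e, he, h⟩ => ⟨e, hF he, h⟩) _ _ h

theorem EdgeConnects.of_mem {F : Set E} {e : E} (he : e ∈ F) {u v : V} (h : ends e = s(u, v)) :
    EdgeConnects ends F u v :=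
  Relation.ReflTransGen.single ⟨e, he, h⟩

theorem edgeConnects_empty_iff {u v : V} : EdgeConnects ends ∅ u v ↔ u = v := by
  constructor
  · intro h
    induction h with
    | refl => rfl
    | tail _ h _ => simp at h
  · rintro rfl
    exact .refl _ _

theorem edgeConnects_insert_iff {F : Set E} {e : E} {u v : V} (he : ends e = s(u, v)) {x y : V} :
    EdgeConnects ends (insert e F) x y ↔ EdgeConnects ends F x y ∨
      (EdgeConnects ends F x u ∧ EdgeConnects ends F v y) ∨
      (EdgeConnects ends F x v ∧ EdgeConnects ends F u y) := by
  constructor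
  · intro h
    induction h with
    | refl => exact .inl (.refl _ _)
    | @tail y z _ h ih =>
      obtain ⟨e', he', h'⟩ := h
      rcases he' with rfl | he'
      · have hyz : (y = u ∧ z = v) ∨ (y = v ∧ z = u) := by
          have := he.symm.trans h'
          rw [Sym2.eq_iff] at this
          tauto
        rcases hyz with ⟨rfl, rfl⟩ | ⟨rfl, rfl⟩
        · rcases ih with h1 | ⟨h1, h2⟩ | ⟨h1, h2⟩
          · exact .inr (.inl ⟨h1, .refl _ _⟩)
          · exact .inr (.inl ⟨h1, .refl _ _⟩)
          · exact .inl h1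
        · rcases ih with h1 | ⟨h1, h2⟩ | ⟨h1, h2⟩
          · exact .inr (.inr ⟨h1, .refl _ _⟩)
          · exact .inl h1
          · exact .inr (.inr ⟨h1, .refl _ _⟩)
      · have hz : EdgeConnects ends F y z := .of_mem he' h'
        rcases ih with h1 | ⟨h1, h2⟩ | ⟨h1, h2⟩
        · exact .inl (h1.trans hz)
        · exact .inr (.inl ⟨h1, h2.trans hz⟩)
        · exact .inr (.inr ⟨h1, h2.trans hz⟩)
  · have huv : EdgeConnects ends (insert e F) u v := .of_mem (Set.mem_insert _ _) he
    have hm : ∀ {a b}, EdgeConnects ends F a b → EdgeConnects ends (insert e F) a b :=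
      fun h => h.mono (Set.subset_insert _ _)
    rintro (h | ⟨h, h'⟩ | ⟨h, h'⟩)
    · exact hm h
    · exact (hm h).trans (huv.trans (hm h'))
    · exact (hm h).trans (huv.symm.trans (hm h'))

theorem isEdgeForest_empty : IsEdgeForest ends ∅ := fun _ he => absurd he (Set.notMem_empty _)

/-- For the converse, a cycle through an old edge that also uses `e` would, with `e` removed,
connect the endpoints of `e` inside `F`. -/
theorem isEdgeForest_insert_iff {F : Set E} {e : E} (heF : e ∉ F) {u v : V}
    (he : ends e = s(u, v)) :
    IsEdgeForest ends (insert e F) ↔ IsEdgeForest ends F ∧ ¬ EdgeConnects ends F u v := by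
  have hdiff : insert e F \ {e} = F := by
    ext x; simp; grind
  constructor
  · intro h
    refine ⟨fun e' he' x y hxy hc => ?_, ?_⟩
    · refine h e' (Set.mem_insert_of_mem _ he') x y hxy (hc.mono ?_)
      exact Set.sdiff_subset_sdiff_left (Set.subset_insert _ _)
    · have := h e (Set.mem_insert _ _) u v he
      rwa [hdiff] at this
  · rintro ⟨hF, huv⟩ e' he' x y hxy hc
    rcases eq_or_ne e' e with rfl | hne
    · rw [hdiff] at hc
      have := he.symm.trans hxy
      rw [Sym2.eq_iff] at this
      rcases this with ⟨rfl, rfl⟩ | ⟨rfl, rfl⟩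
      · exact huv hc
      · exact huv hc.symm
    · have he'F : e' ∈ F := he'.resolve_left hne
      have hset : insert e F \ {e'} = insert e (F \ {e'}) := by
        rw [Set.insert_sdiff_of_notMem]
        simpa using hne.symm
      rw [hset, edgeConnects_insert_iff he] at hc
      have hm : ∀ {a b}, EdgeConnects ends (F \ {e'}) a b → EdgeConnects ends F a b :=
        fun h => h.mono Set.sdiff_subset
      have hxy' : EdgeConnects ends F x y := .of_mem he'F hxy
      rcases hc with hc | ⟨h1, h2⟩ | ⟨h1, h2⟩
      · exact hF e' he'F x y hxy hc
      · exact huv ((hm h1).symm.trans (hxy'.trans (hm h2).symm))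
      · exact huv ((hm h2).trans (hxy'.symm.trans (hm h1)))

variable (ends)

/-- The components of a set of edges. -/
def componentSetoid (F : Set E) : Setoid V where
  r := EdgeConnects ends F
  iseqv := ⟨.refl F, .symm, .trans⟩

variable [Fintype V] [DecidableEq V]

/-- The matrix of the quadratic form `(x u - x v)²` of an edge. -/
def symEdgeMatrix (e : Sym2 V) : Matrix V V ℝ :=
  Sym2.lift ⟨edgeMatrix, edgeMatrix_comm⟩ e

@[simp] theorem symEdgeMatrix_mk (u v : V) : symEdgeMatrix s(u, v) = edgeMatrix u v := rfl

open Classical in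
/-- The determinant of the matrix `S` compressed to the components of `F`. -/
noncomputable def componentDet (F : Set E) (S : Matrix V V ℝ) : ℝ :=
  (compress (Quotient.mk (componentSetoid ends F)) S).det

variable {ends}

/-- Frees `componentDet` from the quotient: any surjection with the components as fibres computes
it, in particular the merging map that arises when an edge is added. -/
theorem componentDet_eq {K : Type*} [Fintype K] [DecidableEq K] (F : Set E) (S : Matrix V V ℝ)
    (f : V → K) (hf : Function.Surjective f)
    (h : ∀ u v, f u = f v ↔ EdgeConnects ends F u v) :
    componentDet ends F S = (compress f S).det := by
  classical
  refine det_compress_congr _ _ Quotient.mk_surjective hf (fun u v => ?_) S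
  rw [h]
  exact Quotient.eq (r := componentSetoid ends F)

theorem componentDet_empty (S : Matrix V V ℝ) : componentDet ends ∅ S = S.det := by
  rw [componentDet_eq ∅ S id Function.surjective_id fun u v => edgeConnects_empty_iff.symm,
    compress_id]

theorem componentDet_add_symEdgeMatrix_of_connects {F : Set E} {e : E} {u v : V}
    (he : ends e = s(u, v)) (huv : EdgeConnects ends F u v) (w : ℝ) (S : Matrix V V ℝ) :
    componentDet ends F (S + w • symEdgeMatrix (ends e)) = componentDet ends F S := by
  classical
  have : Quotient.mk (componentSetoid ends F) u = Quotient.mk (componentSetoid ends F) v :=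
    Quotient.sound huv
  rw [componentDet, he, symEdgeMatrix_mk, compress_add, compress_smul, compress_edgeMatrix, this,
    edgeMatrix_self, smul_zero, add_zero, componentDet]

/-- After compression the edge joins two different components, so `det_add_edgeMatrix` applies, and
merging these two gives the components of `insert e F`. -/
theorem componentDet_add_symEdgeMatrix {F : Set E} {e : E} {u v : V}
    (he : ends e = s(u, v)) (huv : ¬ EdgeConnects ends F u v) (w : ℝ) (S : Matrix V V ℝ) :
    componentDet ends F (S + w • symEdgeMatrix (ends e)) =
      componentDet ends F S + w * componentDet ends (insert e F) S := by
  classical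
  have hq : ∀ x y, Quotient.mk (componentSetoid ends F) x = Quotient.mk (componentSetoid ends F) y ↔
      EdgeConnects ends F x y := fun x y => Quotient.eq (r := componentSetoid ends F)
  have hne : Quotient.mk (componentSetoid ends F) u ≠ Quotient.mk (componentSetoid ends F) v :=
    fun h => huv ((hq _ _).1 h)
  rw [componentDet, he, symEdgeMatrix_mk, compress_add, compress_smul, compress_edgeMatrix,
    det_add_edgeMatrix _ _ hne, ← compress_comp,
    ← componentDet_eq (ends := ends) (insert e F)
      S (mergeMap _ _ hne ∘ Quotient.mk (componentSetoid ends F))]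
  · simp only [componentDet]
  · exact (mergeMap_surjective _ _ hne).comp Quotient.mk_surjective
  · intro x y
    rw [edgeConnects_insert_iff he, Function.comp_apply, Function.comp_apply, mergeMap_eq_iff,
      hq, hq, hq, hq, hq]
    have := fun a b => (⟨EdgeConnects.symm, EdgeConnects.symm⟩ :
      EdgeConnects ends F a b ↔ EdgeConnects ends F b a)
    rw [this v y, this u y]

open Classical in
/-- The all-minors matrix-forest theorem: the determinant of the Laplacian plus an arbitrary matrix
is the weighted sum over forests of the determinants of the compressed matrix. -/
theorem det_sum_symEdgeMatrix_add (w : E → ℝ) (s : Finset E) (S : Matrix V V ℝ) :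
    (∑ e ∈ s, w e • symEdgeMatrix (ends e) + S).det =
      ∑ F ∈ s.powerset, if IsEdgeForest ends (F : Set E) then
        (∏ e ∈ F, w e) * componentDet ends (F : Set E) S else 0 := by
  induction s using Finset.induction_on generalizing S with
  | empty =>
    simp [isEdgeForest_empty, componentDet_empty]
  -- The term of `e` is absorbed into the arbitrary matrix `S` before the induction hypothesis is
  -- used. Each forest `F` of the other edges then yields itself and, unless `e` would close a
  -- cycle, also `insert e F`.
  | insert e s hes ih =>
    rw [Finset.sum_insert hes, Finset.sum_powerset_insert hes, add_comm (w e • _), add_assoc,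
      add_comm (w e • _), ih, ← Finset.sum_add_distrib]
    refine Finset.sum_congr rfl fun F hF => ?_
    have heF : e ∉ F := fun h => hes (Finset.mem_powerset.1 hF h)
    obtain ⟨u, v, he⟩ : ∃ u v, ends e = s(u, v) := by
      induction h : ends e with | _ u v => exact ⟨u, v, rfl⟩
    rw [Finset.coe_insert, isEdgeForest_insert_iff (by simpa using heF) he,
      Finset.prod_insert heF]
    by_cases hf : IsEdgeForest ends (F : Set E)
    · by_cases huv : EdgeConnects ends (F : Set E) u v
      · simp [hf, huv, componentDet_add_symEdgeMatrix_of_connects he huv]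
      · simp only [hf, huv, if_true, not_false_eq_true, and_self,
          componentDet_add_symEdgeMatrix he huv]
        ring
    · simp [hf]

end EdgeForest

/-! ## The determinantal functionals on partitions -/

section PartitionFunctional

open Matrix

variable {n : ℕ}

theorem samePart_iff_mem_part {τ : SetPartition n} {i j : Fin n} :
    SamePart τ i j ↔ i ∈ τ.part j :=
  τ.mem_part_iff_exists.symm

theorem samePart_iff_part_eq {τ : SetPartition n} {i j : Fin n} :
    SamePart τ i j ↔ τ.part i = τ.part j := by
  rw [samePart_iff_mem_part,
    τ.mem_part_iff_part_eq_part (Finset.mem_univ _) (Finset.mem_univ _)]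

theorem setPartition_ext {τ τ' : SetPartition n}
    (h : ∀ i j, SamePart τ i j ↔ SamePart τ' i j) : τ = τ' := by
  have hp : ∀ i, τ.part i = τ'.part i := fun i => by
    ext j
    rw [← samePart_iff_mem_part, ← samePart_iff_mem_part, h]
  have key : ∀ {τ τ' : SetPartition n}, (∀ i, τ.part i = τ'.part i) → τ.parts ⊆ τ'.parts := by
    intro τ τ' h p hp
    obtain ⟨i, hi⟩ := τ.nonempty_of_mem_parts hp
    rw [← τ.part_eq_of_mem hp hi, h]
    exact τ'.part_mem.2 (Finset.mem_univ _)
  ext p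
  exact ⟨fun hq => key hp hq, fun hq => key (fun i => (hp i).symm) hq⟩

theorem exists_setPartition (s : Setoid (Fin n)) :
    ∃ τ : SetPartition n, ∀ i j, SamePart τ i j ↔ s i j := by
  classical
  exact ⟨Finpartition.ofSetoid s, fun i j => by
    rw [samePart_iff_mem_part, Finpartition.mem_part_ofSetoid_iff_rel]
    exact ⟨s.symm', s.symm'⟩⟩

/-- The Gram determinant, for the bilinear form `T`, of the indicator vectors of a family of
sets. -/
def gramDet (T : Matrix (Fin n) (Fin n) ℝ) (s : Finset (Finset (Fin n))) : ℝ :=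
  (Matrix.of fun p q : s => ∑ i ∈ p.1, ∑ j ∈ q.1, T i j).det

/-- The part of an item. -/
def partMap (τ : SetPartition n) (i : Fin n) : τ.parts :=
  ⟨τ.part i, τ.part_mem.2 (Finset.mem_univ _)⟩

theorem partMap_eq_iff {τ : SetPartition n} {i : Fin n} {p : τ.parts} :
    partMap τ i = p ↔ i ∈ p.1 := by
  rw [partMap, Subtype.ext_iff, τ.part_eq_iff_mem p.2]

theorem partMap_surjective (τ : SetPartition n) : Function.Surjective (partMap τ) := fun p => by
  obtain ⟨i, hi⟩ := τ.nonempty_of_mem_parts p.2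
  exact ⟨i, partMap_eq_iff.2 hi⟩

theorem gramDet_parts (T : Matrix (Fin n) (Fin n) ℝ) (τ : SetPartition n) :
    gramDet T τ.parts = (compress (partMap τ) T).det := by
  rw [gramDet]
  congr 1
  ext p q
  rw [of_apply, compress_apply]
  simp only [partMap_eq_iff, ite_and, ← Finset.sum_filter]
  rw [← Finset.sum_subset (Finset.subset_univ p.1)]
  · refine Finset.sum_congr rfl fun i hi => ?_
    simp [hi]
  · intro i _ hi
    simp [hi]

section ForestSum

variable {V E : Type*} [Fintype V] [DecidableEq V] [Fintype E] (ends : E → Sym2 V) (w : E → ℝ)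
  (node : Fin n → V)

open Classical in
/-- The weighted sum of the spanning forests of type `τ` whose trees contain nodes. -/
noncomputable def forestSum (τ : SetPartition n) : ℝ :=
  ∑ F ∈ (Finset.univ : Finset (Finset E)).filter (fun F : Finset E =>
      (IsEdgeForest ends (F : Set E) ∧ ∀ v, ∃ i, EdgeConnects ends (F : Set E) v (node i)) ∧
        ∀ i j, EdgeConnects ends (F : Set E) (node i) (node j) ↔ SamePart τ i j),
    ∏ e ∈ F, w e

/-- In the forest expansion, compressing `T` first to the vertices and then to the components of `F`
sums it over the nodes of each component. A component without nodes gives a zero row, so only groves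
survive, and a grove contributes the Gram determinant of its type. -/
theorem det_add_compress_node (T : Matrix (Fin n) (Fin n) ℝ) :
    (∑ e, w e • symEdgeMatrix (ends e) + compress node T).det =
      ∑ τ : SetPartition n, forestSum ends w node τ * gramDet T τ.parts := by
  classical
  rw [det_sum_symEdgeMatrix_add, Finset.powerset_univ]
  simp only [forestSum, Finset.sum_mul, Finset.sum_filter]
  rw [Finset.sum_comm]
  refine Finset.sum_congr rfl fun F _ => ?_
  obtain ⟨τ, hτ⟩ := exists_setPartition ((componentSetoid ends (F : Set E)).comap node)
  have hτ' : ∀ i j, EdgeConnects ends (F : Set E) (node i) (node j) ↔ SamePart τ i j :=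
    fun i j => (hτ i j).symm
  by_cases hf : IsEdgeForest ends (F : Set E)
  swap
  · simp [hf]
  have hcomp : componentDet ends (F : Set E) (compress node T) =
      (compress (Quotient.mk (componentSetoid ends (F : Set E)) ∘ node) T).det := by
    rw [compress_comp, componentDet]
  by_cases hn : ∀ v, ∃ i, EdgeConnects ends (F : Set E) v (node i)
  · have hu : ∀ τ', (∀ i j, EdgeConnects ends (F : Set E) (node i) (node j) ↔ SamePart τ' i j) ↔
        τ' = τ := by
      intro τ'
      refine ⟨fun h => setPartition_ext fun i j => by rw [← h, hτ'], ?_⟩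
      rintro rfl
      exact hτ'
    simp only [hf, hn, hu, implies_true, and_self, true_and, if_true, ite_mul, zero_mul,
      Finset.sum_ite_eq', Finset.mem_univ]
    rw [hcomp, gramDet_parts]
    congr 1
    refine det_compress_congr _ _ ?_ (partMap_surjective τ) (fun i j => ?_) T
    · intro q
      induction q using Quotient.inductionOn with | _ v =>
      obtain ⟨i, hi⟩ := hn v
      exact ⟨i, Quotient.sound hi.symm⟩
    · rw [partMap_eq_iff, show i ∈ (partMap τ j).1 ↔ _ from samePart_iff_mem_part.symm, ← hτ']
      exact Quotient.eq (r := componentSetoid ends (F : Set E))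
  · rw [hcomp, det_compress_eq_zero]
    · simp [hn]
    · intro h
      refine hn fun v => ?_
      obtain ⟨i, hi⟩ := h (Quotient.mk _ v)
      exact ⟨i, (Quotient.exact hi).symm⟩

end ForestSum

end PartitionFunctional

/-! ## Invariance of the functionals under Rule 1 -/

section RuleInvariance

open Matrix

variable {n : ℕ}

/-- The indicator vector of a set of items. -/
def indicatorVec (p : Finset (Fin n)) : Fin n → ℝ := fun i => if i ∈ p then 1 else 0

theorem indicatorVec_union {p q : Finset (Fin n)} (h : Disjoint p q) :
    indicatorVec (p ∪ q) = indicatorVec p + indicatorVec q := by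
  ext i
  have : i ∈ p → i ∉ q := fun hp => Finset.disjoint_left.1 h hp
  by_cases h1 : i ∈ p <;> by_cases h2 : i ∈ q <;> simp_all [indicatorVec]

theorem sum_sum_eq_dotProduct (T : Matrix (Fin n) (Fin n) ℝ) (p q : Finset (Fin n)) :
    ∑ i ∈ p, ∑ j ∈ q, T i j = indicatorVec p ⬝ᵥ T *ᵥ indicatorVec q := by
  simp [dotProduct, mulVec, indicatorVec]

/-- The family of vectors that consists of `x`, `y`, and the indicator vectors of `R`. -/
def extendFamily (R : Finset (Finset (Fin n))) (x y : Fin n → ℝ) :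
    Option (Option R) → Fin n → ℝ
  | none => x
  | some none => y
  | some (some r) => indicatorVec r.1

/-- The mixed Gram determinant of the families `x, y, R` and `x', y', R`. -/
def mixedDet (T : Matrix (Fin n) (Fin n) ℝ) (R : Finset (Finset (Fin n)))
    (x y x' y' : Fin n → ℝ) : ℝ :=
  (Matrix.of fun k l => extendFamily R x y k ⬝ᵥ T *ᵥ extendFamily R x' y' l).det

variable (T : Matrix (Fin n) (Fin n) ℝ) (R : Finset (Finset (Fin n)))
  (x y x' y' z : Fin n → ℝ)

/-- `T` need not be symmetric; this exchanges the row and column families, so that only row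
operations have to be checked. -/
theorem mixedDet_transpose : mixedDet T R x y x' y' = mixedDet Tᵀ R x' y' x y := by
  rw [mixedDet, mixedDet, ← det_transpose]
  congr 1
  ext k l
  simp only [transpose_apply, of_apply]
  rw [mulVec_transpose, dotProduct_comm (extendFamily R x' y' k), dotProduct_mulVec]

theorem mixedDet_add_left : mixedDet T R (x + z) y x' y' =
    mixedDet T R x y x' y' + mixedDet T R z y x' y' := by
  have h : ∀ x, (Matrix.of fun k l => extendFamily R x y k ⬝ᵥ T *ᵥ extendFamily R x' y' l) =
      updateRow (Matrix.of fun k l => extendFamily R 0 y k ⬝ᵥ T *ᵥ extendFamily R x' y' l) none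
        (fun l => x ⬝ᵥ T *ᵥ extendFamily R x' y' l) := by
    intro x
    ext (_ | _ | k) l <;> simp [extendFamily]
  rw [mixedDet, mixedDet, mixedDet, h (x + z), h x, h z, ← det_updateRow_add]
  congr 2
  ext l
  simp [add_dotProduct]

theorem mixedDet_self_left : mixedDet T R x x x' y' = 0 :=
  det_zero_of_row_eq (i := none) (j := some none) (by simp) rfl

theorem mixedDet_add_self_left : mixedDet T R x (y + x) x' y' = mixedDet T R x y x' y' := by
  symm
  rw [mixedDet, mixedDet, ← det_updateRow_add_self _ (i := some none) (j := none) (by simp)]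
  congr 1
  ext (_ | _ | k) l <;> simp [extendFamily, add_dotProduct]

theorem mixedDet_add_right : mixedDet T R x y (x' + z) y' =
    mixedDet T R x y x' y' + mixedDet T R x y z y' := by
  rw [mixedDet_transpose, mixedDet_add_left, mixedDet_transpose T R x y x',
    mixedDet_transpose T R x y z]

theorem mixedDet_self_right : mixedDet T R x y x' x' = 0 := by
  rw [mixedDet_transpose, mixedDet_self_left]

theorem mixedDet_add_self_right : mixedDet T R x y x' (y' + x') = mixedDet T R x y x' y' := by
  rw [mixedDet_transpose, mixedDet_add_self_left, mixedDet_transpose T R x y x']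

/-- With this, the second vector in every term of the rule becomes the same sum `a + b + c + d`. -/
theorem mixedDet_diag : mixedDet T R x y x y = mixedDet T R x (y + x) x (y + x) := by
  rw [mixedDet_add_self_left, mixedDet_add_self_right]

/-- The relation between Gram determinants that underlies Rule 1. -/
theorem mixedDet_rule (a b c d : Fin n → ℝ) :
    mixedDet T R (a + c) (b + d) (a + c) (b + d) =
      mixedDet T R a (b + c + d) a (b + c + d) + mixedDet T R b (a + c + d) b (a + c + d) +
      mixedDet T R c (a + b + d) c (a + b + d) + mixedDet T R d (a + b + c) d (a + b + c) -
      mixedDet T R (a + b) (c + d) (a + b) (c + d) -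
      mixedDet T R (a + d) (b + c) (a + d) (b + c) := by
  have e : ∀ x y, y + x = a + b + c + d → mixedDet T R x y x y =
      mixedDet T R x (a + b + c + d) x (a + b + c + d) := by
    intro x y h
    rw [mixedDet_diag, h]
  -- Write s = a + b + c + d and B(x, z) for `mixedDet T R x s z s`. Then B(s, z) = B(z, s) = 0, and
  -- the rule says that B(x, x) summed over x = a+b, a+c, a+d equals its sum over x = a, b, c, d.
  -- Expanding, this is exactly B(s, a) + B(a, s) = 0.
  have hl : ∀ z, mixedDet T R (a + b + c + d) (a + b + c + d) z (a + b + c + d) = 0 :=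
    fun z => mixedDet_self_left _ _ _ _ _
  have hr : ∀ z, mixedDet T R z (a + b + c + d) (a + b + c + d) (a + b + c + d) = 0 :=
    fun z => mixedDet_self_right _ _ _ _ _
  rw [e (a + c) _ (by abel), e a _ (by abel), e b _ (by abel), e c _ (by abel), e d _ (by abel),
    e (a + b) _ (by abel), e (a + d) _ (by abel)]
  have hl := hl a
  have hr := hr a
  simp only [mixedDet_add_left, mixedDet_add_right] at hl hr ⊢
  linear_combination hl + hr

theorem gramDet_insert_insert {X Y : Finset (Fin n)} (hX : X ∉ insert Y R) (hY : Y ∉ R) :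
    gramDet T (insert X (insert Y R)) =
      mixedDet T R (indicatorVec X) (indicatorVec Y) (indicatorVec X) (indicatorVec Y) := by
  let e : ↥(insert X (insert Y R)) ≃ Option (Option R) :=
    (Finset.subtypeInsertEquivOption hX).trans
      (Equiv.optionCongr (Finset.subtypeInsertEquivOption hY))
  rw [gramDet, mixedDet, ← det_submatrix_equiv_self e.symm]
  congr 1
  have h : ∀ k, extendFamily R (indicatorVec X) (indicatorVec Y) k =
      indicatorVec (e.symm k).1 := by
    rintro (_ | _ | k) <;> rfl
  ext k l
  simp only [submatrix_apply, of_apply, h, sum_sum_eq_dotProduct]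

variable (φ : SetPartition n → ℝ)

/-- The additive extension of `φ` to formal linear combinations is unchanged by Rule 1. -/
def IsRuleInvariant : Prop :=
  ∀ τ r, Rule1 τ r → Finsupp.linearCombination ℤ φ r = φ τ

variable {φ}

theorem IsRuleInvariant.copies (hφ : IsRuleInvariant φ) {x y : PartitionComb n}
    (h : Relation.ReflTransGen Rule1StepCopies x y) :
    Finsupp.linearCombination ℤ φ y = Finsupp.linearCombination ℤ φ x := by
  induction h with
  | refl => rfl
  | tail _ h ih =>
    obtain ⟨τ, r, k, hr, rfl⟩ := h
    simp [hφ τ r hr, ih]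

theorem reflTransGen_copies_of_step {x y : PartitionComb n}
    (h : Relation.ReflTransGen Rule1Step x y) : Relation.ReflTransGen Rule1StepCopies x y :=
  Relation.ReflTransGen.mono (fun _ _ ⟨τ, r, hr, _, hy⟩ => ⟨τ, r, _, hr, hy⟩) _ _ h

theorem linearCombination_planarComb (c : PlanarPartition n → ℤ) :
    Finsupp.linearCombination ℤ φ (planarComb c) = ∑ σ, (c σ : ℝ) * φ σ.1 := by
  simp [planarComb]

theorem isRuleInvariant_gramDet : IsRuleInvariant (fun τ : SetPartition n => gramDet T τ.parts) := by
  rintro τ r ⟨A, B, C, D, a, b, c, d, -, -, -, ha, hb, hc, hd, hAC, hBD, hACτ, hBDτ, hne,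
    ρA, ρB, ρC, ρD, ρAB, ρAD, hA, hB, hC, hD, hAB, hAD, rfl⟩
  set R := τ.parts \ {A ∪ C, B ∪ D} with hR
  have hdisj : Disjoint (A ∪ C) (B ∪ D) := τ.disjoint hACτ hBDτ hne
  -- No new part occurs among the untouched ones, since it shares an item with the union of the two
  -- replaced parts.
  have hnot : ∀ (X : Finset (Fin n)) (i : Fin n), i ∈ X → i ∈ (A ∪ C) ∪ (B ∪ D) → X ∉ R := by
    intro X i hiX hi hXR
    rw [hR, Finset.mem_sdiff] at hXR
    apply hXR.2
    rcases Finset.mem_union.1 hi with hi | hi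
    · simp [τ.eq_of_mem_parts hXR.1 hACτ hiX hi]
    · simp [τ.eq_of_mem_parts hXR.1 hBDτ hiX hi]
  have hτ : τ.parts = {A ∪ C, B ∪ D} ∪ R := by
    rw [hR, Finset.union_sdiff_of_subset]
    simp [Finset.insert_subset_iff, hACτ, hBDτ]
  have key : ∀ (ρ : SetPartition n) (X Y : Finset (Fin n)) (i j : Fin n),
      ρ.parts = {X, Y} ∪ R → i ∈ X → j ∈ Y → i ∈ (A ∪ C) ∪ (B ∪ D) → j ∈ (A ∪ C) ∪ (B ∪ D) →
      i ∉ Y → gramDet T ρ.parts = mixedDet T R (indicatorVec X) (indicatorVec Y)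
        (indicatorVec X) (indicatorVec Y) := by
    intro ρ X Y i j hρ hiX hjY hi hj hiY
    have h1 : X ∉ insert Y R := by
      rw [Finset.mem_insert, not_or]
      exact ⟨fun h => hiY (h ▸ hiX), hnot X i hiX hi⟩
    rw [hρ, Finset.insert_union, Finset.singleton_union,
      gramDet_insert_insert T R h1 (hnot Y j hjY hj)]
  have d1 := hAC
  have d2 := hBD
  simp only [Finset.disjoint_union_left, Finset.disjoint_union_right] at hdisj
  obtain ⟨⟨dAB, dCB⟩, dAD, dCD⟩ := hdisj
  have nm : ∀ {X Y : Finset (Fin n)} {i}, Disjoint X Y → i ∈ X → i ∉ Y :=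
    fun h hX => Finset.disjoint_left.1 h hX
  have nm' : ∀ {X Y : Finset (Fin n)} {i}, Disjoint Y X → i ∈ X → i ∉ Y :=
    fun h hX => Finset.disjoint_right.1 h hX
  simp only [map_sub, map_add, Finsupp.linearCombination_single, one_smul]
  rw [key τ (A ∪ C) (B ∪ D) a b hτ (by simp [ha]) (by simp [hb]) (by simp [ha]) (by simp [hb])
      (by simp [nm dAB ha, nm dAD ha]),
    key ρA A (B ∪ C ∪ D) a b hA ha (by simp [hb]) (by simp [ha]) (by simp [hb])
      (by simp [nm dAB ha, nm dAD ha, nm hAC ha]),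
    key ρB B (A ∪ C ∪ D) b a hB hb (by simp [ha]) (by simp [hb]) (by simp [ha])
      (by simp [nm' dAB hb, nm hBD hb, nm' dCB hb]),
    key ρC C (A ∪ B ∪ D) c a hC hc (by simp [ha]) (by simp [hc]) (by simp [ha])
      (by simp [nm dCB hc, nm dCD hc, nm' hAC hc]),
    key ρD D (A ∪ B ∪ C) d a hD hd (by simp [ha]) (by simp [hd]) (by simp [ha])
      (by simp [nm' dAD hd, nm' dCD hd, nm' hBD hd]),
    key ρAB (A ∪ B) (C ∪ D) a c hAB (by simp [ha]) (by simp [hc]) (by simp [ha]) (by simp [hc])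
      (by simp [nm hAC ha, nm dAD ha]),
    key ρAD (A ∪ D) (B ∪ C) a b hAD (by simp [ha]) (by simp [hb]) (by simp [ha]) (by simp [hb])
      (by simp [nm hAC ha, nm dAB ha])]
  have u3 : ∀ {X Y Z : Finset (Fin n)}, Disjoint X Y → Disjoint X Z → Disjoint Y Z →
      indicatorVec (X ∪ Y ∪ Z) = indicatorVec X + indicatorVec Y + indicatorVec Z := by
    intro X Y Z h1 h2 h3
    rw [indicatorVec_union (Finset.disjoint_union_left.2 ⟨h2, h3⟩), indicatorVec_union h1]
  rw [indicatorVec_union hAC, indicatorVec_union hBD, u3 dCB.symm hBD dCD, u3 hAC dAD dCD,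
    u3 dAB dAD hBD, u3 dAB hAC dCB.symm, indicatorVec_union dAB, indicatorVec_union dCD,
    indicatorVec_union dAD, indicatorVec_union dCB.symm]
  exact (mixedDet_rule T R _ _ _ _).symm

open Classical in
/-- The coefficient of the partition into singletons is unchanged by Rule 1. -/
theorem isRuleInvariant_bot :
    IsRuleInvariant (fun τ : SetPartition n => if τ = ⊥ then (1 : ℝ) else 0) := by
  -- Each of the seven partitions in an instance has a part with at least two items, so `⊥` occurs
  -- on neither side of the rule.
  have hbot : ∀ (ρ : SetPartition n) (X : Finset (Fin n)) (i j : Fin n), X ∈ ρ.parts →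
      i ∈ X → j ∈ X → i ≠ j → ρ ≠ ⊥ := by
    rintro ρ X i j hX hi hj hij rfl
    rw [Finpartition.parts_bot, Finset.mem_map] at hX
    obtain ⟨k, -, rfl⟩ := hX
    simp at hi hj
    exact hij (hi.trans hj.symm)
  rintro τ r ⟨A, B, C, D, a, b, c, d, hab, hbc, hcd, ha, hb, hc, hd, hAC, hBD, hACτ, hBDτ, hne,
    ρA, ρB, ρC, ρD, ρAB, ρAD, hA, hB, hC, hD, hAB, hAD, rfl⟩
  have h0 := hbot τ (A ∪ C) a c hACτ (by simp [ha]) (by simp [hc]) (hab.trans hbc).ne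
  have h1 := hbot ρA (B ∪ C ∪ D) b c (by simp [hA]) (by simp [hb]) (by simp [hc]) hbc.ne
  have h2 := hbot ρB (A ∪ C ∪ D) a c (by simp [hB]) (by simp [ha]) (by simp [hc])
    (hab.trans hbc).ne
  have h3 := hbot ρC (A ∪ B ∪ D) a b (by simp [hC]) (by simp [ha]) (by simp [hb]) hab.ne
  have h4 := hbot ρD (A ∪ B ∪ C) a b (by simp [hD]) (by simp [ha]) (by simp [hb]) hab.ne
  have h5 := hbot ρAB (A ∪ B) a b (by simp [hAB]) (by simp [ha]) (by simp [hb]) hab.ne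
  have h6 := hbot ρAD (B ∪ C) b c (by simp [hAD]) (by simp [hb]) (by simp [hc]) hbc.ne
  simp [h0, h1, h2, h3, h4, h5, h6]

end RuleInvariance

/-! ## Planar partitions and the extreme elements of their parts -/

section Planar

variable {n : ℕ}

theorem SamePart.symm {τ : SetPartition n} {i j : Fin n} (h : SamePart τ i j) : SamePart τ j i := by
  rw [samePart_iff_part_eq] at h ⊢
  exact h.symm

theorem SamePart.trans {τ : SetPartition n} {i j k : Fin n} (h : SamePart τ i j)
    (h' : SamePart τ j k) : SamePart τ i k := by
  rw [samePart_iff_part_eq] at h h' ⊢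
  exact h.trans h'

theorem SamePart.refl (τ : SetPartition n) (i : Fin n) : SamePart τ i i :=
  samePart_iff_part_eq.2 rfl

theorem IsPlanarPartition.samePart {τ : SetPartition n} (h : IsPlanarPartition τ)
    {a b c d : Fin n} (hab : a < b) (hbc : b < c) (hcd : c < d) (hac : SamePart τ a c)
    (hbd : SamePart τ b d) : SamePart τ a b := by
  obtain ⟨p, hp, hap, hcp⟩ := hac
  obtain ⟨q, hq, hbq, hdq⟩ := hbd
  by_cases hpq : p = q
  · exact ⟨p, hp, hap, hpq ▸ hbq⟩
  · exact absurd ⟨a, b, c, d, hab, hbc, hcd, hap, hcp, hbq, hdq⟩ (h p hp q hq hpq)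

theorem part_nonempty' (τ : SetPartition n) (i : Fin n) : (τ.part i).Nonempty :=
  τ.part_nonempty.2 (Finset.mem_univ _)

/-- The smallest item in the part of `i`. -/
def partMin (τ : SetPartition n) (i : Fin n) : Fin n := (τ.part i).min' (part_nonempty' τ i)

/-- The largest item in the part of `i`. -/
def partMax (τ : SetPartition n) (i : Fin n) : Fin n := (τ.part i).max' (part_nonempty' τ i)

variable {τ σ ρ : SetPartition n} {i j : Fin n}

theorem samePart_partMin (τ : SetPartition n) (i : Fin n) : SamePart τ (partMin τ i) i :=
  samePart_iff_mem_part.2 (Finset.min'_mem _ _)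

theorem samePart_partMax (τ : SetPartition n) (i : Fin n) : SamePart τ (partMax τ i) i :=
  samePart_iff_mem_part.2 (Finset.max'_mem _ _)

theorem partMin_le (h : SamePart τ i j) : partMin τ i ≤ j :=
  Finset.min'_le _ _ (samePart_iff_mem_part.1 h.symm)

theorem le_partMax (h : SamePart τ i j) : j ≤ partMax τ i :=
  Finset.le_max' _ _ (samePart_iff_mem_part.1 h.symm)

theorem partMin_congr (h : SamePart τ i j) : partMin τ i = partMin τ j := by
  simp only [partMin, samePart_iff_part_eq.1 h]

theorem partMax_congr (h : SamePart τ i j) : partMax τ i = partMax τ j := by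
  simp only [partMax, samePart_iff_part_eq.1 h]

theorem partMin_partMin (τ : SetPartition n) (i : Fin n) :
    partMin τ (partMin τ i) = partMin τ i := partMin_congr (samePart_partMin τ i)

theorem partMax_partMax (τ : SetPartition n) (i : Fin n) :
    partMax τ (partMax τ i) = partMax τ i := partMax_congr (samePart_partMax τ i)

theorem samePart_of_partMin_eq (h : partMin τ i = partMin τ j) : SamePart τ i j :=
  (samePart_partMin τ i).symm.trans (h ▸ samePart_partMin τ j)

theorem samePart_of_partMax_eq (h : partMax τ i = partMax τ j) : SamePart τ i j :=
  (samePart_partMax τ i).symm.trans (h ▸ samePart_partMax τ j)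

/-- Let m be the minimum of the `ρ`-part of `x`; it is also a minimum in `σ`. Let z be the maximum
of the `σ`-part of m. If z < x, induction puts z in the `ρ`-part of `x`, although z is a maximum in
`ρ`. If z = x, the minima agree. If z > x, the `σ`-parts of `x` and of m cross. -/
theorem not_partMin_lt (hσ : IsPlanarPartition σ)
    (hmin : ∀ i, partMin ρ i = i → partMin σ i = i)
    (hmax : ∀ i, partMax σ i = i → partMax ρ i = i) (x : Fin n)
    (ih : ∀ y < x, partMin σ y = partMin ρ y) : ¬ partMin σ x < partMin ρ x := by
  intro hlt
  set m := partMin ρ x with hm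
  have hm' : partMin σ m = m := hmin m (partMin_partMin ρ x)
  have hmx : m ≤ x := partMin_le (SamePart.refl ρ x)
  have hmne : m ≠ x := by
    intro h
    rw [h] at hm' hlt
    exact hlt.ne hm'
  set z := partMax σ m with hz
  have hzm : SamePart σ z m := samePart_partMax σ m
  rcases lt_trichotomy z x with hzx | hzx | hzx
  · have h1 : partMin ρ z = partMin ρ x := by
      rw [← ih z hzx, partMin_congr hzm, hm']
    have h2 := le_partMax (samePart_of_partMin_eq h1)
    rw [hmax z (partMax_partMax σ m)] at h2
    exact absurd hzx h2.not_gt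
  · rw [hzx] at hzm
    rw [partMin_congr hzm, hm'] at hlt
    exact lt_irrefl _ hlt
  · have h := hσ.samePart hlt (lt_of_le_of_ne hmx hmne) hzx (samePart_partMin σ x) hzm.symm
    have h2 := partMin_congr h
    rw [partMin_partMin, hm'] at h2
    exact hlt.ne h2

/-- A planar partition is determined by the smallest and the largest items of its parts. -/
theorem planar_ext (hσ : IsPlanarPartition σ) (hρ : IsPlanarPartition ρ)
    (hmin : ∀ i, partMin σ i = i ↔ partMin ρ i = i)
    (hmax : ∀ i, partMax σ i = i ↔ partMax ρ i = i) : σ = ρ := by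
  have key : ∀ x, partMin σ x = partMin ρ x := by
    intro x
    induction x using WellFoundedLT.induction with | _ x ih =>
    refine le_antisymm (not_lt.1 ?_) (not_lt.1 ?_)
    · exact not_partMin_lt hρ (fun i => (hmin i).1) (fun i => (hmax i).2) x
        fun y hy => (ih y hy).symm
    · exact not_partMin_lt hσ (fun i => (hmin i).2) (fun i => (hmax i).1) x ih
  refine setPartition_ext fun i j => ⟨fun h => ?_, fun h => ?_⟩
  · exact samePart_of_partMin_eq (by rw [← key, ← key, partMin_congr h])
  · exact samePart_of_partMin_eq (by rw [key, key, partMin_congr h])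

/-- The smallest items of the parts. -/
def minItems (τ : SetPartition n) : Finset (Fin n) := {i | partMin τ i = i}

/-- The largest items of the parts. -/
def maxItems (τ : SetPartition n) : Finset (Fin n) := {i | partMax τ i = i}

@[simp] theorem mem_minItems : i ∈ minItems τ ↔ partMin τ i = i := by simp [minItems]

@[simp] theorem mem_maxItems : i ∈ maxItems τ ↔ partMax τ i = i := by simp [maxItems]

theorem card_maxItems (τ : SetPartition n) : (maxItems τ).card = (minItems τ).card := by
  refine le_antisymm ?_ ?_
  · refine Finset.card_le_card_of_injOn (partMin τ) (fun i _ => ?_) fun i hi j hj h => ?_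
    · simp [partMin_partMin]
    · have := partMax_congr (samePart_of_partMin_eq h)
      simp at hi hj
      rwa [hi, hj] at this
  · refine Finset.card_le_card_of_injOn (partMax τ) (fun i _ => ?_) fun i hi j hj h => ?_
    · simp [partMax_partMax]
    · have := partMin_congr (samePart_of_partMax_eq h)
      simp at hi hj
      rwa [hi, hj] at this

open Classical in
/-- The matrix with a unit entry for the smallest and the largest item of each part. -/
noncomputable def extremeMatrix (τ : SetPartition n) : Matrix (Fin n) (Fin n) ℝ :=
  Matrix.of fun i j => if SamePart τ i j ∧ partMin τ i = i ∧ partMax τ j = j then 1 else 0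

theorem gramDet_extremeMatrix_self (τ : SetPartition n) :
    gramDet (extremeMatrix τ) τ.parts = 1 := by
  classical
  rw [gramDet]
  convert Matrix.det_one (n := τ.parts) (R := ℝ)
  ext p q
  rw [Matrix.of_apply]
  rcases eq_or_ne p q with rfl | hpq
  · rw [Matrix.one_apply_eq]
    obtain ⟨k, hk⟩ := τ.nonempty_of_mem_parts p.2
    have hp : ∀ i, i ∈ p.1 ↔ SamePart τ i k := fun i => by
      rw [samePart_iff_mem_part, τ.part_eq_of_mem p.2 hk]
    rw [Finset.sum_eq_single (partMin τ k), Finset.sum_eq_single (partMax τ k)]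
    · have : SamePart τ (partMin τ k) (partMax τ k) :=
        (samePart_partMin τ k).trans (samePart_partMax τ k).symm
      simp [extremeMatrix, this, partMin_partMin, partMax_partMax]
    · intro j hj hne
      have : partMax τ j ≠ j := by
        rw [partMax_congr ((hp j).1 hj)]
        exact hne.symm
      simp [extremeMatrix, this]
    · intro h
      exact absurd ((hp _).2 (samePart_partMax τ k)) h
    · intro i hi hne
      have : partMin τ i ≠ i := by
        rw [partMin_congr ((hp i).1 hi)]
        exact hne.symm
      simp [extremeMatrix, this]
    · intro h
      exact absurd ((hp _).2 (samePart_partMin τ k)) h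
  · rw [Matrix.one_apply_ne hpq]
    refine Finset.sum_eq_zero fun i hi => Finset.sum_eq_zero fun j hj => ?_
    have : ¬ SamePart τ i j := by
      rw [samePart_iff_part_eq, τ.part_eq_of_mem p.2 hi, τ.part_eq_of_mem q.2 hj]
      exact fun h => hpq (Subtype.ext h)
    simp [extremeMatrix, this]

/-- A part of `ρ` that misses all minima, or all maxima, of `σ` gives a zero row, or a zero column,
of the Gram matrix. -/
theorem exists_of_gramDet_extremeMatrix_ne_zero (h : gramDet (extremeMatrix σ) ρ.parts ≠ 0)
    (k : Fin n) : (∃ i, SamePart ρ i k ∧ partMin σ i = i) ∧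
      ∃ j, SamePart ρ j k ∧ partMax σ j = j := by
  have hk : ∀ i, i ∈ (partMap ρ k).1 ↔ SamePart ρ i k := fun i => samePart_iff_mem_part.symm
  constructor
  · by_contra! hno
    refine h (Matrix.det_eq_zero_of_row_eq_zero (partMap ρ k) fun q => ?_)
    refine Finset.sum_eq_zero fun i hi => Finset.sum_eq_zero fun j hj => ?_
    simp [extremeMatrix, hno i ((hk i).1 hi)]
  · by_contra! hno
    refine h (Matrix.det_eq_zero_of_column_eq_zero (partMap ρ k) fun q => ?_)
    refine Finset.sum_eq_zero fun i hi => Finset.sum_eq_zero fun j hj => ?_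
    simp [extremeMatrix, hno j ((hk j).1 hj)]

theorem image_partMin_minItems (h : gramDet (extremeMatrix σ) ρ.parts ≠ 0) :
    (minItems σ).image (partMin ρ) = minItems ρ := by
  ext k
  simp only [Finset.mem_image, mem_minItems]
  constructor
  · rintro ⟨i, -, rfl⟩
    exact partMin_partMin ρ i
  · intro hk
    obtain ⟨i, hik, hi⟩ := (exists_of_gramDet_extremeMatrix_ne_zero h k).1
    exact ⟨i, hi, by rw [partMin_congr hik, hk]⟩

theorem image_partMax_maxItems (h : gramDet (extremeMatrix σ) ρ.parts ≠ 0) :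
    (maxItems σ).image (partMax ρ) = maxItems ρ := by
  ext k
  simp only [Finset.mem_image, mem_maxItems]
  constructor
  · rintro ⟨i, -, rfl⟩
    exact partMax_partMax ρ i
  · intro hk
    obtain ⟨i, hik, hi⟩ := (exists_of_gramDet_extremeMatrix_ne_zero h k).2
    exact ⟨i, hi, by rw [partMax_congr hik, hk]⟩

/-- The total width of the parts, negated. -/
def negWidth (τ : SetPartition n) : ℤ :=
  ∑ i ∈ minItems τ, (i : ℤ) - ∑ i ∈ maxItems τ, (i : ℤ)

/-- A nonzero determinant forces `ρ` to have at most as many parts as `σ`, hence equally many. Then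
`partMin ρ` maps the minima of `σ` bijectively onto those of `ρ` without raising any, and `partMax
ρ` acts likewise on the maxima without lowering any. The width hypothesis makes both maps the
identity. -/
theorem eq_of_gramDet_extremeMatrix_ne_zero (hσ : IsPlanarPartition σ) (hρ : IsPlanarPartition ρ)
    (h : gramDet (extremeMatrix σ) ρ.parts ≠ 0) (hcard : (minItems σ).card ≤ (minItems ρ).card)
    (hw : (minItems σ).card = (minItems ρ).card → negWidth σ ≤ negWidth ρ) : ρ = σ := by
  have hI := image_partMin_minItems h
  have hJ := image_partMax_maxItems h
  have hcard' : (minItems σ).card = (minItems ρ).card :=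
    le_antisymm hcard (hI ▸ Finset.card_image_le)
  have hinjI : Set.InjOn (partMin ρ) (minItems σ) := by
    rw [← Finset.card_image_iff, hI, hcard']
  have hinjJ : Set.InjOn (partMax ρ) (maxItems σ) := by
    rw [← Finset.card_image_iff, hJ, card_maxItems, card_maxItems, hcard']
  have hsI : ∑ i ∈ minItems ρ, (i : ℤ) = ∑ i ∈ minItems σ, (partMin ρ i : ℤ) := by
    rw [← hI, Finset.sum_image hinjI]
  have hsJ : ∑ i ∈ maxItems ρ, (i : ℤ) = ∑ i ∈ maxItems σ, (partMax ρ i : ℤ) := by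
    rw [← hJ, Finset.sum_image hinjJ]
  have hleI : ∀ i ∈ minItems σ, (partMin ρ i : ℤ) ≤ (i : ℤ) := fun i _ => by
    exact_mod_cast partMin_le (SamePart.refl ρ i)
  have hleJ : ∀ i ∈ maxItems σ, (i : ℤ) ≤ (partMax ρ i : ℤ) := fun i _ => by
    exact_mod_cast le_partMax (SamePart.refl ρ i)
  have hw' := hw hcard'
  rw [negWidth, negWidth, hsI, hsJ] at hw'
  have h1 := Finset.sum_le_sum hleI
  have h2 := Finset.sum_le_sum hleJ
  have e1 := (Finset.sum_eq_sum_iff_of_le hleI).1 (by linarith)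
  have e2 := (Finset.sum_eq_sum_iff_of_le hleJ).1 (by linarith)
  have hIeq : minItems σ = minItems ρ := by
    refine Finset.eq_of_subset_of_card_le (fun i hi => ?_) hcard'.ge
    rw [mem_minItems]
    exact Fin.ext (by exact_mod_cast e1 i hi)
  have hJeq : maxItems σ = maxItems ρ := by
    refine Finset.eq_of_subset_of_card_le (fun i hi => ?_) ?_
    · rw [mem_maxItems]
      exact Fin.ext (by exact_mod_cast (e2 i hi).symm)
    · rw [card_maxItems, card_maxItems, hcard']
  refine planar_ext hρ hσ (fun i => ?_) fun i => ?_
  · rw [← mem_minItems, ← mem_minItems, hIeq]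
  · rw [← mem_maxItems, ← mem_maxItems, hJeq]

/-- The Gram determinants separate the combinations of planar partitions. -/
theorem eq_zero_of_sum_gramDet_eq_zero (c : PlanarPartition n → ℝ)
    (h : ∀ T, ∑ σ, c σ * gramDet T σ.1.parts = 0) : c = 0 := by
  classical
  by_contra hc
  obtain ⟨σ', hσ'⟩ := Function.ne_iff.1 hc
  -- Among the partitions in the support take one with the fewest parts and, among those, the
  -- largest total width. No other partition in the support then contributes to the test with its
  -- extreme matrix.
  obtain ⟨σ, hσ, hmin⟩ := Finset.exists_min_image (Finset.univ.filter fun σ => c σ ≠ 0)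
    (fun σ => toLex ((minItems σ.1).card, negWidth σ.1)) ⟨σ', by simpa using hσ'⟩
  have hcσ : c σ ≠ 0 := by simpa using hσ
  have h1 := h (extremeMatrix σ.1)
  rw [Finset.sum_eq_single σ, gramDet_extremeMatrix_self, mul_one] at h1
  · exact hcσ h1
  · intro ρ _ hne
    by_contra hmul
    obtain ⟨hcρ, hdet⟩ := mul_ne_zero_iff.1 hmul
    have hle := hmin ρ (by simpa using hcρ)
    rw [Prod.Lex.toLex_le_toLex] at hle
    refine hne (Subtype.ext (eq_of_gramDet_extremeMatrix_ne_zero σ.2 ρ.2 hdet ?_ ?_))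
    · rcases hle with hle | hle
      · exact hle.le
      · exact hle.1.le
    · intro heq
      rcases hle with hle | hle
      · exact absurd heq hle.ne
      · exact hle.2
  · simp

end Planar

/-! ## Reduction to planar partitions -/

section Reduction

variable {n : ℕ}

/-- The distance between the smallest and the largest item of a set. -/
def itemSpan (T : Finset (Fin n)) : ℤ :=
  if h : T.Nonempty then ((T.max' h : ℕ) : ℤ) - ((T.min' h : ℕ) : ℤ) else 0

theorem itemSpan_le {T : Finset (Fin n)} (hT : T.Nonempty) {lo hi : ℤ}
    (h : ∀ i ∈ T, lo ≤ ((i : ℕ) : ℤ) ∧ ((i : ℕ) : ℤ) ≤ hi) : itemSpan T ≤ hi - lo := by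
  rw [itemSpan, dif_pos hT]
  have h1 := h _ (T.max'_mem hT)
  have h2 := h _ (T.min'_mem hT)
  linarith [h1.2, h2.1]

theorem itemSpan_eq {T : Finset (Fin n)} {i j : Fin n} (hi : i ∈ T) (hj : j ∈ T)
    (h : ∀ k ∈ T, i ≤ k ∧ k ≤ j) : itemSpan T = ((j : ℕ) : ℤ) - ((i : ℕ) : ℤ) := by
  have hT : T.Nonempty := ⟨i, hi⟩
  have h1 : T.max' hT = j := le_antisymm (T.max'_le hT _ fun k hk => (h k hk).2) (T.le_max' _ hj)
  have h2 : T.min' hT = i := le_antisymm (T.min'_le _ hi) (T.le_min' hT _ fun k hk => (h k hk).1)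
  rw [itemSpan, dif_pos hT, h1, h2]

/-- Replacing `X`, `Y` by `X'`, `Y'` lowers the total span, or keeps it and makes the spans more
unequal, or keeps the spans and moves items to parts of smaller span. -/
def PairLT (X' Y' X Y : Finset (Fin n)) : Prop :=
  itemSpan X' + itemSpan Y' < itemSpan X + itemSpan Y ∨
  (itemSpan X' + itemSpan Y' = itemSpan X + itemSpan Y ∧
    (itemSpan X ^ 2 + itemSpan Y ^ 2 < itemSpan X' ^ 2 + itemSpan Y' ^ 2 ∨
    (itemSpan X ^ 2 + itemSpan Y ^ 2 = itemSpan X' ^ 2 + itemSpan Y' ^ 2 ∧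
      X'.card * itemSpan X' + Y'.card * itemSpan Y' <
        X.card * itemSpan X + Y.card * itemSpan Y)))

/-- All replacements of a Rule 1 move are smaller. -/
def SmallerMove (A B C D : Finset (Fin n)) : Prop :=
  PairLT A (B ∪ C ∪ D) (A ∪ C) (B ∪ D) ∧ PairLT B (A ∪ C ∪ D) (A ∪ C) (B ∪ D) ∧
  PairLT C (A ∪ B ∪ D) (A ∪ C) (B ∪ D) ∧ PairLT D (A ∪ B ∪ C) (A ∪ C) (B ∪ D) ∧
  PairLT (A ∪ B) (C ∪ D) (A ∪ C) (B ∪ D) ∧ PairLT (A ∪ D) (B ∪ C) (A ∪ C) (B ∪ D)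

theorem pairLT_of_bounds {X' Y' X Y : Finset (Fin n)} (hX : X'.Nonempty) (hY : Y'.Nonempty)
    (lo hi lo' hi' : ℤ) (h : ∀ i ∈ X', lo ≤ ((i : ℕ) : ℤ) ∧ ((i : ℕ) : ℤ) ≤ hi)
    (h' : ∀ i ∈ Y', lo' ≤ ((i : ℕ) : ℤ) ∧ ((i : ℕ) : ℤ) ≤ hi')
    (hlt : hi - lo + (hi' - lo') < itemSpan X + itemSpan Y) : PairLT X' Y' X Y :=
  .inl (lt_of_le_of_lt (add_le_add (itemSpan_le hX h) (itemSpan_le hY h')) hlt)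

/-- `X = A ∪ C` spans [p, r] and `Y = B ∪ D` spans [q, s], with p < q < r < s. Only AD|BC keeps the
total span, and its spans s - p and r - q are more unequal than r - p and s - q. -/
theorem smallerMove_interleaved {A B C D : Finset (Fin n)} {p q r s : Fin n}
    (hp : p ∈ A) (hq : q ∈ B) (hr : r ∈ C) (hs : s ∈ D) (hpq : p < q) (hqr : q < r) (hrs : r < s)
    (hA : ∀ i ∈ A, p ≤ i ∧ i < q) (hB : ∀ i ∈ B, q ≤ i ∧ i < r) (hC : ∀ i ∈ C, q < i ∧ i ≤ r)
    (hD : ∀ i ∈ D, r < i ∧ i ≤ s) : SmallerMove A B C D := by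
  have nA : A.Nonempty := ⟨p, hp⟩
  have nB : B.Nonempty := ⟨q, hq⟩
  have nC : C.Nonempty := ⟨r, hr⟩
  have nD : D.Nonempty := ⟨s, hs⟩
  have eX : itemSpan (A ∪ C) = (r : ℕ) - (p : ℕ) := by
    refine itemSpan_eq (by simp [hp]) (by simp [hr]) fun k hk => ?_
    rcases Finset.mem_union.1 hk with hk | hk
    · have := hA k hk; grind
    · have := hC k hk; grind
  have eY : itemSpan (B ∪ D) = (s : ℕ) - (q : ℕ) := by
    refine itemSpan_eq (by simp [hq]) (by simp [hs]) fun k hk => ?_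
    rcases Finset.mem_union.1 hk with hk | hk
    · have := hB k hk; grind
    · have := hD k hk; grind
  have eAD : itemSpan (A ∪ D) = (s : ℕ) - (p : ℕ) := by
    refine itemSpan_eq (by simp [hp]) (by simp [hs]) fun k hk => ?_
    rcases Finset.mem_union.1 hk with hk | hk
    · have := hA k hk; grind
    · have := hD k hk; grind
  have eBC : itemSpan (B ∪ C) = (r : ℕ) - (q : ℕ) := by
    refine itemSpan_eq (by simp [hq]) (by simp [hr]) fun k hk => ?_
    rcases Finset.mem_union.1 hk with hk | hk
    · have := hB k hk; grind
    · have := hC k hk; grind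
  simp only [Fin.lt_def, Fin.le_def] at *
  -- The shifts by one encode strict bounds on integers; for B|ACD and C|ABD they alone make the
  -- total span strictly smaller.
  refine ⟨pairLT_of_bounds nA (by simp [nB]) p (q - 1) q s (by grind) ?_ (by omega),
    pairLT_of_bounds nB (by simp [nA]) q (r - 1) p s (by grind) ?_ (by omega),
    pairLT_of_bounds nC (by simp [nA]) (q + 1) r p s (by grind) ?_ (by omega),
    pairLT_of_bounds nD (by simp [nA]) (r + 1) s p r (by grind) ?_ (by omega),
    pairLT_of_bounds (by simp [nA]) (by simp [nC]) p (r - 1) (q + 1) s (by grind) (by grind)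
      (by omega), .inr ⟨?_, .inl ?_⟩⟩
  · grind
  · grind
  · grind
  · grind
  · omega
  · rw [eX, eY, eAD, eBC]
    have h1 : (0 : ℤ) < (q : ℕ) - (p : ℕ) := by omega
    have h2 : (0 : ℤ) < (s : ℕ) - (r : ℕ) := by omega
    nlinarith [mul_pos h1 h2]

/-- Here `B ∪ D` lies inside the span of `A`. Only A|BCD keeps the spans, and it moves the items of
`C` from the wide part to the narrow one, which lowers the sum of size times span. -/
theorem smallerMove_nested {A B C D : Finset (Fin n)} {p q x r s : Fin n}
    (hp : p ∈ A) (hs : s ∈ A) (hq : q ∈ B) (hx : x ∈ C) (hr : r ∈ D) (hpq : p < q) (hqx : q < x)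
    (hxr : x < r) (hrs : r < s) (hAC : Disjoint A C) (hdisj : Disjoint C (B ∪ D))
    (hA : ∀ i ∈ A, p ≤ i ∧ i ≤ s) (hB : ∀ i ∈ B, q ≤ i ∧ i < x) (hC : ∀ i ∈ C, q < i ∧ i < r)
    (hD : ∀ i ∈ D, x < i ∧ i ≤ r) : SmallerMove A B C D := by
  have nA : A.Nonempty := ⟨p, hp⟩
  have nB : B.Nonempty := ⟨q, hq⟩
  have nC : C.Nonempty := ⟨x, hx⟩
  have nD : D.Nonempty := ⟨r, hr⟩
  have eX : itemSpan (A ∪ C) = (s : ℕ) - (p : ℕ) := by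
    refine itemSpan_eq (by simp [hp]) (by simp [hs]) fun k hk => ?_
    rcases Finset.mem_union.1 hk with hk | hk
    · have := hA k hk; grind
    · have := hC k hk; grind
  have eY : itemSpan (B ∪ D) = (r : ℕ) - (q : ℕ) := by
    refine itemSpan_eq (by simp [hq]) (by simp [hr]) fun k hk => ?_
    rcases Finset.mem_union.1 hk with hk | hk
    · have := hB k hk; grind
    · have := hD k hk; grind
  have eA : itemSpan A = (s : ℕ) - (p : ℕ) := itemSpan_eq hp hs hA
  have eBCD : itemSpan (B ∪ C ∪ D) = (r : ℕ) - (q : ℕ) := by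
    refine itemSpan_eq (by simp [hq]) (by simp [hr]) fun k hk => ?_
    simp only [Finset.mem_union] at hk
    rcases hk with (hk | hk) | hk
    · have := hB k hk; grind
    · have := hC k hk; grind
    · have := hD k hk; grind
  have cAC : (A ∪ C).card = A.card + C.card := Finset.card_union_of_disjoint hAC
  have cBCD : (B ∪ C ∪ D).card = C.card + (B ∪ D).card := by
    rw [← Finset.card_union_of_disjoint hdisj]
    congr 1
    ext i; simp; tauto
  have cC : 0 < C.card := nC.card_pos
  simp only [Fin.lt_def, Fin.le_def] at *
  refine ⟨.inr ⟨by omega, .inr ⟨by rw [eX, eY, eA, eBCD], ?_⟩⟩,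
    pairLT_of_bounds nB (by simp [nA]) q (x - 1) p s (by grind) ?_ (by omega),
    pairLT_of_bounds nC (by simp [nA]) (q + 1) (r - 1) p s (by grind) ?_ (by omega),
    pairLT_of_bounds nD (by simp [nA]) (x + 1) r p s (by grind) ?_ (by omega),
    pairLT_of_bounds (by simp [nA]) (by simp [nC]) p s (q + 1) r ?_ ?_ (by omega),
    pairLT_of_bounds (by simp [nA]) (by simp [nC]) p s q (r - 1) ?_ ?_ (by omega)⟩
  · rw [eX, eY, eA, eBCD, cAC, cBCD]
    have h1 : (0 : ℤ) < C.card := by exact_mod_cast cC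
    have h2 : (0 : ℤ) < (q : ℕ) - (p : ℕ) + ((s : ℕ) - (r : ℕ)) := by omega
    push_cast
    nlinarith [mul_pos h1 h2]
  all_goals grind

theorem exists_smallerMove {τ : SetPartition n} (hτ : ¬ IsPlanarPartition τ) :
    ∃ (A B C D : Finset (Fin n)) (a b c d : Fin n),
      a < b ∧ b < c ∧ c < d ∧ a ∈ A ∧ b ∈ B ∧ c ∈ C ∧ d ∈ D ∧
      Disjoint A C ∧ Disjoint B D ∧ A ∪ C ∈ τ.parts ∧ B ∪ D ∈ τ.parts ∧ A ∪ C ≠ B ∪ D ∧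
      SmallerMove A B C D := by
  -- Of the two crossing parts, X is the one with the smaller minimum. The item x of X lies strictly
  -- between two items of Y: it is c or b, according to which part X is.
  obtain ⟨X, Y, hX, hY, hXY, p, q, hp, hq, hpmin, hqmin, hpq, r, s, hr, hs, hrmax, hsmax, x, hx,
      hqx, hxs⟩ : ∃ X Y : Finset (Fin n), X ∈ τ.parts ∧ Y ∈ τ.parts ∧ Disjoint X Y ∧
      ∃ p q : Fin n, p ∈ X ∧ q ∈ Y ∧ (∀ i ∈ X, p ≤ i) ∧ (∀ i ∈ Y, q ≤ i) ∧ p < q ∧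
      ∃ r s : Fin n, r ∈ X ∧ s ∈ Y ∧ (∀ i ∈ X, i ≤ r) ∧ (∀ i ∈ Y, i ≤ s) ∧
      ∃ x ∈ X, q < x ∧ (x < s ∨ r < s) := by
    simp only [IsPlanarPartition, not_forall, not_not] at hτ
    obtain ⟨X, hX, Y, hY, hXY, a, b, c, d, hab, hbc, hcd, ha, hc, hb, hd⟩ := hτ
    have hdisj : Disjoint X Y := τ.disjoint hX hY hXY
    have nX := τ.nonempty_of_mem_parts hX
    have nY := τ.nonempty_of_mem_parts hY
    have hne : X.min' nX ≠ Y.min' nY := fun h =>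
      Finset.disjoint_left.1 hdisj (X.min'_mem nX) (h ▸ Y.min'_mem nY)
    rcases lt_or_gt_of_ne hne with hlt | hlt
    · exact ⟨X, Y, hX, hY, hdisj, _, _, X.min'_mem nX, Y.min'_mem nY, fun i => X.min'_le i,
        fun i => Y.min'_le i, hlt, _, _, X.max'_mem nX, Y.max'_mem nY, fun i => X.le_max' i,
        fun i => Y.le_max' i, c, hc, (Y.min'_le b hb).trans_lt hbc,
        .inl (hcd.trans_le (Y.le_max' d hd))⟩
    · exact ⟨Y, X, hY, hX, hdisj.symm, _, _, Y.min'_mem nY, X.min'_mem nX, fun i => Y.min'_le i,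
        fun i => X.min'_le i, hlt, _, _, Y.max'_mem nY, X.max'_mem nX, fun i => Y.le_max' i,
        fun i => X.le_max' i, b, hb, (X.min'_le a ha).trans_lt hab,
        .inl (hbc.trans_le (X.le_max' c hc))⟩
  have hnm : ∀ {i}, i ∈ X → i ∉ Y := fun h => Finset.disjoint_left.1 hXY h
  have hne : X ≠ Y := fun h => hnm hp (h ▸ hp)
  have hrs : r ≠ s := fun h => hnm hr (h ▸ hs)
  rcases lt_or_gt_of_ne hrs with hlt | hlt
  -- Interleaved spans: cut X at the minimum of Y, and Y at the maximum of X.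
  · have hqr : q < r := hqx.trans_le (hrmax x hx)
    have eX : X.filter (· < q) ∪ X.filter (¬ · < q) = X := Finset.filter_union_filter_not_eq _ _
    have eY : Y.filter (· < r) ∪ Y.filter (¬ · < r) = Y := Finset.filter_union_filter_not_eq _ _
    have hxq : ∀ i ∈ X, i ≠ q := fun i hi h => hnm hi (h ▸ hq)
    have hyr : ∀ i ∈ Y, i ≠ r := fun i hi h => hnm hr (h ▸ hi)
    refine ⟨X.filter (· < q), Y.filter (· < r), X.filter (¬ · < q), Y.filter (¬ · < r), p, q, r, s,
      hpq, hqr, hlt, by simp [hp, hpq], by simp [hq, hqr], by simp [hr, hqr.le],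
      by simp [hs, hlt.le], Finset.disjoint_filter_filter_not _ _ _,
      Finset.disjoint_filter_filter_not _ _ _, by rwa [eX], by rwa [eY], by rwa [eX, eY], ?_⟩
    refine smallerMove_interleaved (p := p) (q := q) (r := r) (s := s) (by simp [hp, hpq])
      (by simp [hq, hqr]) (by simp [hr, hqr.le]) (by simp [hs, hlt.le]) hpq hqr hlt ?_ ?_ ?_ ?_
    all_goals
      intro i hi
      simp only [Finset.mem_filter] at hi
      grind
  -- Nested spans: C collects the items of X inside the span of Y, and Y is cut at one of them.
  · have hxs : x < s := by
      rcases hxs with h | h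
      · exact h
      · exact absurd h hlt.not_gt
    have eX : X.filter (fun i => ¬ (q < i ∧ i < s)) ∪ X.filter (fun i => q < i ∧ i < s) = X := by
      rw [Finset.union_comm]
      exact Finset.filter_union_filter_not_eq _ _
    have eY : Y.filter (· < x) ∪ Y.filter (¬ · < x) = Y := Finset.filter_union_filter_not_eq _ _
    have hyx : ∀ i ∈ Y, i ≠ x := fun i hi h => hnm hx (h ▸ hi)
    have hd : Disjoint (X.filter (fun i => ¬ (q < i ∧ i < s)))
      (X.filter (fun i => q < i ∧ i < s)) := (Finset.disjoint_filter_filter_not _ _ _).symm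
    refine ⟨X.filter (fun i => ¬ (q < i ∧ i < s)), Y.filter (· < x),
      X.filter (fun i => q < i ∧ i < s), Y.filter (¬ · < x), p, q, x, s,
      hpq, hqx, hxs, by simp [hp]; grind, by simp [hq, hqx], by simp [hx, hqx, hxs],
      by simp [hs, hxs.le], hd,
      Finset.disjoint_filter_filter_not _ _ _, by rwa [eX], by rwa [eY], by rwa [eX, eY], ?_⟩
    refine smallerMove_nested (p := p) (q := q) (x := x) (r := s) (s := r) (by simp [hp]; grind)
      (by simp [hr]; grind) (by simp [hq, hqx]) (by simp [hx, hqx, hxs]) (by simp [hs, hxs.le])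
      hpq hqx hxs hlt hd ?_ ?_ ?_ ?_ ?_
    · rw [eY]
      exact hXY.mono_left (Finset.filter_subset _ _)
    all_goals
      intro i hi
      simp only [Finset.mem_filter] at hi
      grind

end Reduction

/-! ### Termination of the reduction and uniqueness of its result -/

section Termination

variable {n : ℕ}

/-- Two parts of a partition may be replaced by another partition of their union. -/
theorem exists_replace {τ : SetPartition n} {X Y X' Y' : Finset (Fin n)} (hX : X ∈ τ.parts)
    (hY : Y ∈ τ.parts) (hXY : X ≠ Y) (hX' : X'.Nonempty) (hY' : Y'.Nonempty)
    (hd : Disjoint X' Y') (hu : X' ∪ Y' = X ∪ Y) :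
    ∃ ρ : SetPartition n, ρ.parts = {X', Y'} ∪ (τ.parts \ {X, Y}) ∧
      ∀ f : Finset (Fin n) → ℤ, ∑ p ∈ ρ.parts, f p + (f X + f Y) =
        ∑ p ∈ τ.parts, f p + (f X' + f Y') := by
  have hmem : ∀ i, (i ∈ X' ∨ i ∈ Y') ↔ (i ∈ X ∨ i ∈ Y) := fun i => by
    rw [← Finset.mem_union, hu, Finset.mem_union]
  have hnd : ∀ i, i ∈ X' → i ∉ Y' := fun i h => Finset.disjoint_left.1 hd h
  have hrest : ∀ p ∈ τ.parts \ {X, Y}, ∀ i ∈ p, ¬ (i ∈ X ∨ i ∈ Y) := by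
    intro p hp i hi h
    simp only [Finset.mem_sdiff, Finset.mem_insert, Finset.mem_singleton, not_or] at hp
    rcases h with h | h
    · exact hp.2.1 (τ.eq_of_mem_parts hp.1 hX hi h)
    · exact hp.2.2 (τ.eq_of_mem_parts hp.1 hY hi h)
  let ρ : SetPartition n := Finpartition.ofExistsUnique ({X', Y'} ∪ (τ.parts \ {X, Y}))
    (fun p _ => Finset.subset_univ p) (fun i _ => by
      by_cases hi : i ∈ X ∨ i ∈ Y
      · have hno : ∀ p ∈ τ.parts \ {X, Y}, i ∉ p := fun p hp h => hrest p hp i h hi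
        rcases (hmem i).2 hi with h | h
        · refine ⟨X', ⟨by simp, h⟩, fun p hp => ?_⟩
          have := hno p
          have := hnd i h
          simp only [Finset.mem_union, Finset.mem_insert, Finset.mem_singleton] at hp
          grind
        · refine ⟨Y', ⟨by simp, h⟩, fun p hp => ?_⟩
          have := hno p
          have := hnd i
          simp only [Finset.mem_union, Finset.mem_insert, Finset.mem_singleton] at hp
          grind
      · have hi' : ¬ (i ∈ X' ∨ i ∈ Y') := by rwa [hmem]
        refine ⟨τ.part i, ⟨?_, τ.mem_part (Finset.mem_univ _)⟩, fun p hp => ?_⟩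
        · have h1 : τ.part i ∈ τ.parts := τ.part_mem.2 (Finset.mem_univ _)
          have h2 : i ∈ τ.part i := τ.mem_part (Finset.mem_univ _)
          simp only [Finset.mem_union, Finset.mem_insert, Finset.mem_singleton, Finset.mem_sdiff]
          grind
        · have h1 : p ∈ τ.parts → i ∈ p → τ.part i = p := fun h h' => τ.part_eq_of_mem h h'
          simp only [Finset.mem_union, Finset.mem_insert, Finset.mem_singleton,
            Finset.mem_sdiff] at hp
          grind)
    (by
      simp only [Finset.mem_union, Finset.mem_insert, Finset.mem_singleton, Finset.mem_sdiff]
      rintro ((h | h) | h)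
      · exact hX'.ne_empty h.symm
      · exact hY'.ne_empty h.symm
      · exact τ.ne_empty h.1 rfl)
  have hρ : ρ.parts = {X', Y'} ∪ (τ.parts \ {X, Y}) := rfl
  refine ⟨ρ, hρ, fun f => ?_⟩
  have hX'Y' : X' ≠ Y' := by
    rintro rfl
    obtain ⟨i, hi⟩ := hX'
    exact hnd i hi hi
  have hdis : Disjoint ({X', Y'} : Finset (Finset (Fin n))) (τ.parts \ {X, Y}) := by
    rw [Finset.disjoint_left]
    intro p hp hp'
    simp only [Finset.mem_insert, Finset.mem_singleton] at hp
    rcases hp with rfl | rfl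
    · obtain ⟨i, hi⟩ := hX'
      exact hrest _ hp' i hi ((hmem i).1 (.inl hi))
    · obtain ⟨i, hi⟩ := hY'
      exact hrest _ hp' i hi ((hmem i).1 (.inr hi))
  have hsub : ({X, Y} : Finset (Finset (Fin n))) ⊆ τ.parts := by
    simp [Finset.insert_subset_iff, hX, hY]
  rw [hρ, Finset.sum_union hdis, Finset.sum_pair hX'Y', ← Finset.sum_sdiff hsub,
    Finset.sum_pair hXY]
  ring

/-- The measure which Rule 1 can be made to decrease. -/
def ruleMeasure (τ : SetPartition n) : ℤ ×ₗ ℤ ×ₗ ℤ :=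
  toLex (∑ p ∈ τ.parts, itemSpan p,
    toLex (-∑ p ∈ τ.parts, itemSpan p ^ 2, ∑ p ∈ τ.parts, p.card * itemSpan p))

theorem ruleMeasure_lt {τ ρ : SetPartition n} {X Y X' Y' : Finset (Fin n)}
    (h : ∀ f : Finset (Fin n) → ℤ, ∑ p ∈ ρ.parts, f p + (f X + f Y) =
        ∑ p ∈ τ.parts, f p + (f X' + f Y')) (hlt : PairLT X' Y' X Y) :
    ruleMeasure ρ < ruleMeasure τ := by
  have h1 := h itemSpan
  have h2 := h fun p => itemSpan p ^ 2
  have h3 := h fun p => p.card * itemSpan p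
  rw [ruleMeasure, ruleMeasure, Prod.Lex.toLex_lt_toLex, Prod.Lex.toLex_lt_toLex]
  rcases hlt with hlt | ⟨heq, hlt | ⟨heq', hlt⟩⟩
  · left; dsimp only; linarith
  · right; refine ⟨by dsimp only; linarith, .inl ?_⟩; dsimp only; linarith
  · right; refine ⟨by dsimp only; linarith, .inr ⟨?_, ?_⟩⟩ <;> dsimp only <;> linarith

theorem exists_rule1_smaller {τ : SetPartition n} (hτ : ¬ IsPlanarPartition τ) :
    ∃ (r : PartitionComb n) (S : Finset (SetPartition n)), Rule1 τ r ∧ r.support ⊆ S ∧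
      S.card ≤ 6 ∧ ∀ ρ ∈ S, ruleMeasure ρ < ruleMeasure τ := by
  classical
  obtain ⟨A, B, C, D, a, b, c, d, hab, hbc, hcd, ha, hb, hc, hd, hAC, hBD, hX, hY, hne,
    m1, m2, m3, m4, m5, m6⟩ := exists_smallerMove hτ
  have hdisj : Disjoint (A ∪ C) (B ∪ D) := τ.disjoint hX hY hne
  simp only [Finset.disjoint_union_left, Finset.disjoint_union_right] at hdisj
  obtain ⟨⟨dAB, dCB⟩, dAD, dCD⟩ := hdisj
  have nA : A.Nonempty := ⟨a, ha⟩
  have nB : B.Nonempty := ⟨b, hb⟩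
  have nC : C.Nonempty := ⟨c, hc⟩
  have nD : D.Nonempty := ⟨d, hd⟩
  obtain ⟨ρA, hA, sA⟩ := exists_replace (X' := A) (Y' := B ∪ C ∪ D) hX hY hne nA (by simp [nB])
    (by simp [dAB, hAC, dAD]) (by ext; simp; tauto)
  obtain ⟨ρB, hB, sB⟩ := exists_replace (X' := B) (Y' := A ∪ C ∪ D) hX hY hne nB (by simp [nA])
    (by simp [dAB.symm, dCB.symm, hBD]) (by ext; simp; tauto)
  obtain ⟨ρC, hC, sC⟩ := exists_replace (X' := C) (Y' := A ∪ B ∪ D) hX hY hne nC (by simp [nA])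
    (by simp [hAC.symm, dCB, dCD]) (by ext; simp; tauto)
  obtain ⟨ρD, hD, sD⟩ := exists_replace (X' := D) (Y' := A ∪ B ∪ C) hX hY hne nD (by simp [nA])
    (by simp [dAD.symm, dCD.symm, hBD.symm]) (by ext; simp; tauto)
  obtain ⟨ρAB, hAB, sAB⟩ := exists_replace (X' := A ∪ B) (Y' := C ∪ D) hX hY hne (by simp [nA])
    (by simp [nC]) (by simp [hAC, dAD, dCB.symm, hBD]) (by ext; simp; tauto)
  obtain ⟨ρAD, hAD, sAD⟩ := exists_replace (X' := A ∪ D) (Y' := B ∪ C) hX hY hne (by simp [nA])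
    (by simp [nC]) (by simp [hAC, dAB, dCD.symm, hBD.symm]) (by ext; simp; tauto)
  refine ⟨_, {ρA, ρB, ρC, ρD, ρAB, ρAD}, ⟨A, B, C, D, a, b, c, d, hab, hbc, hcd, ha, hb, hc, hd,
    hAC, hBD, hX, hY, hne, ρA, ρB, ρC, ρD, ρAB, ρAD, hA, hB, hC, hD, hAB, hAD, rfl⟩, ?_,
    Finset.card_le_six, ?_⟩
  · intro ρ hρ
    by_contra hno
    simp only [Finset.mem_insert, Finset.mem_singleton, not_or] at hno
    simp [Ne.symm hno.1, Ne.symm hno.2.1, Ne.symm hno.2.2.1,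
      Ne.symm hno.2.2.2.1, Ne.symm hno.2.2.2.2.1, Ne.symm hno.2.2.2.2.2] at hρ
  · intro ρ hρ
    simp only [Finset.mem_insert, Finset.mem_singleton] at hρ
    rcases hρ with rfl | rfl | rfl | rfl | rfl | rfl
    exacts [ruleMeasure_lt sA m1, ruleMeasure_lt sB m2, ruleMeasure_lt sC m3, ruleMeasure_lt sD m4,
      ruleMeasure_lt sAB m5, ruleMeasure_lt sAD m6]

/-- The number of partitions of smaller measure. -/
noncomputable def ruleRank (τ : SetPartition n) : ℕ :=
  (Finset.univ.filter fun ρ : SetPartition n => ruleMeasure ρ < ruleMeasure τ).card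

theorem ruleRank_lt {τ ρ : SetPartition n} (h : ruleMeasure ρ < ruleMeasure τ) :
    ruleRank ρ < ruleRank τ := by
  refine Finset.card_lt_card (Finset.ssubset_iff_of_subset ?_ |>.2 ⟨ρ, ?_, ?_⟩)
  · intro π hπ
    simp only [Finset.mem_filter, Finset.mem_univ, true_and] at hπ ⊢
    exact hπ.trans h
  · simpa using h
  · simp

open Classical in
/-- A potential that decreases when a nonplanar partition is replaced by smaller ones. -/
noncomputable def rulePotential (x : PartitionComb n) : ℕ :=
  ∑ τ ∈ x.support.filter (fun τ => ¬ IsPlanarPartition τ), 7 ^ ruleRank τ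

/-- At most six partitions of smaller rank replace `τ`, and 6 · 7^k < 7^(k+1); hence the base 7 in
`rulePotential`. Coefficients play no role, only the support does. -/
theorem exists_step_lt {x : PartitionComb n} {τ : SetPartition n} (hx : x τ ≠ 0)
    (hτ : ¬ IsPlanarPartition τ) :
    ∃ y, Rule1Step x y ∧ rulePotential y < rulePotential x := by
  classical
  obtain ⟨r, S, hr, hrS, hS, hlt⟩ := exists_rule1_smaller hτ
  refine ⟨_, ⟨τ, r, hr, hx, rfl⟩, ?_⟩
  set y := x + x τ • (r - Finsupp.single τ 1) with hy
  -- Since `τ` does not reappear on the right, replacing its whole coefficient removes it from the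
  -- support.
  have hτS : τ ∉ S := fun h => lt_irrefl _ (hlt τ h)
  have hrτ : r τ = 0 := by
    by_contra h
    exact hτS (hrS (Finsupp.mem_support_iff.2 h))
  have hyτ : y τ = 0 := by simp [hy, hrτ]
  have hsub : y.support.filter (fun τ => ¬ IsPlanarPartition τ) ⊆
      (x.support.filter (fun τ => ¬ IsPlanarPartition τ)).erase τ ∪ S := by
    intro ρ hρ
    rw [Finset.mem_filter, Finsupp.mem_support_iff] at hρ
    have hne : ρ ≠ τ := by
      rintro rfl
      exact hρ.1 hyτ
    by_cases hρS : ρ ∈ S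
    · exact Finset.mem_union_right _ hρS
    · have h0 : r ρ = 0 := by
        by_contra h
        exact hρS (hrS (Finsupp.mem_support_iff.2 h))
      have : y ρ = x ρ := by simp [hy, h0, hne.symm]
      refine Finset.mem_union_left _ (Finset.mem_erase.2 ⟨hne, Finset.mem_filter.2 ⟨?_, hρ.2⟩⟩)
      rw [Finsupp.mem_support_iff, ← this]
      exact hρ.1
  have hmem : τ ∈ x.support.filter (fun τ => ¬ IsPlanarPartition τ) := by
    simp [hx, hτ]
  have hSsum : ∑ ρ ∈ S, 7 ^ ruleRank ρ < 7 ^ ruleRank τ := by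
    rcases S.eq_empty_or_nonempty with rfl | ⟨ρ₀, hρ₀⟩
    · simp
    · have hpos : 0 < ruleRank τ := (Nat.zero_le _).trans_lt (ruleRank_lt (hlt ρ₀ hρ₀))
      obtain ⟨k, hk⟩ : ∃ k, ruleRank τ = k + 1 := ⟨_, (Nat.succ_pred_eq_of_pos hpos).symm⟩
      have hle : ∀ ρ ∈ S, 7 ^ ruleRank ρ ≤ 7 ^ k := fun ρ hρ =>
        Nat.pow_le_pow_right (by norm_num) (by have := ruleRank_lt (hlt ρ hρ); omega)
      calc ∑ ρ ∈ S, 7 ^ ruleRank ρ ≤ S.card • 7 ^ k := Finset.sum_le_card_nsmul _ _ _ hle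
        _ ≤ 6 * 7 ^ k := by rw [smul_eq_mul]; exact Nat.mul_le_mul_right _ hS
        _ < 7 ^ ruleRank τ := by
          rw [hk, pow_succ]
          have : 0 < 7 ^ k := by positivity
          omega
  calc rulePotential y ≤ ∑ ρ ∈ (x.support.filter (fun τ => ¬ IsPlanarPartition τ)).erase τ ∪ S,
        7 ^ ruleRank ρ := Finset.sum_le_sum_of_subset hsub
    _ ≤ ∑ ρ ∈ (x.support.filter (fun τ => ¬ IsPlanarPartition τ)).erase τ, 7 ^ ruleRank ρ +
        ∑ ρ ∈ S, 7 ^ ruleRank ρ := by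
      rw [← Finset.sum_union_inter]
      exact Nat.le_add_right _ _
    _ < rulePotential x := by
      rw [rulePotential, ← Finset.sum_erase_add _ _ hmem]
      exact Nat.add_lt_add_left hSsum _

theorem eq_planarComb {y : PartitionComb n} (hy : ∀ ρ ∈ y.support, IsPlanarPartition ρ) :
    y = planarComb fun σ => y σ.1 := by
  classical
  ext τ
  rw [planarComb, Finsupp.finsetSum_apply]
  by_cases hτ : IsPlanarPartition τ
  · rw [Finset.sum_eq_single ⟨τ, hτ⟩]
    · simp
    · intro σ _ hne
      rw [Finsupp.single_apply, if_neg]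
      exact fun h => hne (Subtype.ext h)
    · simp
  · rw [Finset.sum_eq_zero]
    · by_contra h
      exact hτ (hy τ (Finsupp.mem_support_iff.2 h))
    · intro σ _
      rw [Finsupp.single_apply, if_neg]
      rintro rfl
      exact hτ σ.2

/-- Every combination can be transformed into a combination of planar partitions. -/
theorem exists_reduction (x : PartitionComb n) :
    ∃ c : PlanarPartition n → ℤ, Relation.ReflTransGen Rule1Step x (planarComb c) := by
  induction h : rulePotential x using Nat.strong_induction_on generalizing x with
  | _ N ih =>
    by_cases hx : ∀ ρ ∈ x.support, IsPlanarPartition ρ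
    · refine ⟨fun σ => x σ.1, ?_⟩
      rw [← eq_planarComb hx]
    · push Not at hx
      obtain ⟨τ, hτx, hτ⟩ := hx
      obtain ⟨y, hxy, hlt⟩ := exists_step_lt (Finsupp.mem_support_iff.1 hτx) hτ
      obtain ⟨c, hc⟩ := ih _ (h ▸ hlt) y rfl
      exact ⟨c, .head hxy hc⟩

/-- Combinations of planar partitions that arise from the same combination agree. -/
theorem planarComb_unique {x : PartitionComb n} {c c' : PlanarPartition n → ℤ}
    (h : Relation.ReflTransGen Rule1StepCopies x (planarComb c))
    (h' : Relation.ReflTransGen Rule1StepCopies x (planarComb c')) : c = c' := by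
  -- All Gram functionals take the value of `x` on both results, and they separate planar
  -- combinations.
  have key := eq_zero_of_sum_gramDet_eq_zero (fun σ => (c σ : ℝ) - c' σ) fun T => by
    have e := (isRuleInvariant_gramDet T).copies h
    have e' := (isRuleInvariant_gramDet T).copies h'
    rw [linearCombination_planarComb] at e e'
    simp only [sub_mul, Finset.sum_sub_distrib, e, e', sub_self]
  ext σ
  have := congrFun key σ
  simp only [Pi.zero_apply, sub_eq_zero] at this
  exact_mod_cast this

end Termination

/-! ## The response matrix and groves -/

section CompleteGraph

open Matrix

variable {V : Type*} [Fintype V] [DecidableEq V]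

theorem symEdgeMatrix_apply (z : Sym2 V) (u v : V) :
    symEdgeMatrix z u v = (if u = v then ∑ w, if z = s(u, w) then (1 : ℝ) else 0 else 0) -
      if z = s(u, v) then 1 else 0 := by
  induction z with | _ a b =>
  have hsum : ∑ w, (if s(a, b) = s(u, w) then (1 : ℝ) else 0) =
      if a = u ∨ b = u then 1 else 0 := by
    by_cases ha : a = u
    · subst ha
      simp only [Sym2.congr_right]
      simp
    · by_cases hb : b = u
      · subst hb
        simp [ha]
      · simp [ha, hb]
  rw [hsum]
  simp only [symEdgeMatrix_mk, edgeMatrix, vecMulVec_apply, Pi.sub_apply, Pi.single_apply,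
    Sym2.eq_iff]
  by_cases huv : u = v
  · subst huv
    by_cases ha : a = u <;> by_cases hb : b = u <;> simp [ha, hb, eq_comm (a := u)]
  · by_cases ha : a = u <;> by_cases hb : b = u <;> by_cases ha' : a = v <;>
      by_cases hb' : b = v <;> simp_all [eq_comm]

theorem edgeMatrix_mulVec (a b : V) (x : V → ℝ) :
    edgeMatrix a b *ᵥ x = (x a - x b) • (Pi.single a 1 - Pi.single b 1) := by
  rw [edgeMatrix, vecMulVec_mulVec, sub_dotProduct]
  ext i
  simp [mul_comm]

theorem symEdgeMatrix_mulVec_one (z : Sym2 V) : symEdgeMatrix z *ᵥ 1 = 0 := by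
  induction z with | _ a b =>
  rw [symEdgeMatrix_mk, edgeMatrix_mulVec]
  simp

variable {n : ℕ}

/-- The edges of the complete graph on the nodes. -/
abbrev NodePair (n : ℕ) : Type := {p : Fin n × Fin n // p.1 < p.2}

/-- The endpoints of an edge of the complete graph. -/
def pairEnds (e : NodePair n) : Sym2 (Fin n) := s(e.1.1, e.1.2)

theorem pairEnds_eq_iff {i j : Fin n} (hij : i < j) (e : NodePair n) :
    pairEnds e = s(i, j) ↔ e = ⟨(i, j), hij⟩ := by
  obtain ⟨⟨a, b⟩, hab⟩ := e
  simp only [pairEnds, Sym2.eq_iff, Subtype.mk.injEq, Prod.mk.injEq]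
  refine or_iff_left ?_
  rintro ⟨rfl, rfl⟩
  exact lt_asymm hab hij

/-- A symmetric matrix with zero row sums is the Laplacian of a weighted complete graph. -/
theorem eq_sum_symEdgeMatrix (M : Matrix (Fin n) (Fin n) ℝ) (hM : Mᵀ = M) (hM1 : M *ᵥ 1 = 0) :
    M = ∑ e : NodePair n, (-M) e.1.1 e.1.2 • symEdgeMatrix (pairEnds e) := by
  set N := ∑ e : NodePair n, (-M) e.1.1 e.1.2 • symEdgeMatrix (pairEnds e) with hN
  have hlt : ∀ i j, i < j → N i j = M i j ∧ N j i = M i j := by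
    intro i j hij
    simp only [hN, Matrix.sum_apply, Matrix.smul_apply, symEdgeMatrix_apply, hij.ne, hij.ne', if_false, zero_sub,
      smul_eq_mul]
    rw [Sym2.eq_swap (a := j) (b := i)]
    simp [pairEnds_eq_iff hij]
  have hoff : ∀ i j, i ≠ j → N i j = M i j := by
    intro i j hij
    rcases lt_or_gt_of_ne hij with h | h
    · exact (hlt i j h).1
    · rw [(hlt j i h).2]
      exact congrFun (congrFun hM i) j
  -- The off-diagonal entries agree; vanishing row sums on both sides then force the diagonal
  -- entries to agree.
  have hN1 : N *ᵥ 1 = 0 := by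
    rw [hN, sum_mulVec]
    exact Finset.sum_eq_zero fun e _ => by rw [smul_mulVec, symEdgeMatrix_mulVec_one, smul_zero]
  ext i j
  rcases eq_or_ne i j with rfl | hij
  · have h1 := congrFun hM1 i
    have h2 := congrFun hN1 i
    simp only [mulVec, dotProduct, Pi.one_apply, mul_one, Pi.zero_apply] at h1 h2
    rw [← Finset.add_sum_erase _ _ (Finset.mem_univ i)] at h1 h2
    have h3 : ∑ j ∈ Finset.univ.erase i, N i j = ∑ j ∈ Finset.univ.erase i, M i j :=
      Finset.sum_congr rfl fun j hj => hoff i j (Finset.ne_of_mem_erase hj).symm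
    linarith
  · exact (hoff i j hij).symm

/-- The edges of a graph on the nodes. -/
def graphPairs (F : SimpleGraph (Fin n)) : Set (NodePair n) := {e | F.Adj e.1.1 e.1.2}

theorem exists_mem_graphPairs_iff {F : SimpleGraph (Fin n)} {i j : Fin n} :
    (∃ e ∈ graphPairs F, pairEnds e = s(i, j)) ↔ F.Adj i j := by
  constructor
  · rintro ⟨e, he, h⟩
    have he' : F.Adj e.1.1 e.1.2 := he
    rw [← SimpleGraph.mem_edgeSet] at he' ⊢
    exact h ▸ he'
  · intro h
    rcases lt_or_gt_of_ne h.ne with hij | hij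
    · exact ⟨⟨(i, j), hij⟩, h, rfl⟩
    · exact ⟨⟨(j, i), hij⟩, h.symm, Sym2.eq_swap⟩

theorem edgeConnects_graphPairs_iff {F : SimpleGraph (Fin n)} {i j : Fin n} :
    EdgeConnects pairEnds (graphPairs F) i j ↔ F.Reachable i j := by
  rw [SimpleGraph.reachable_iff_reflTransGen, EdgeConnects]
  simp only [exists_mem_graphPairs_iff]

theorem graphPairs_deleteEdges (F : SimpleGraph (Fin n)) (e : NodePair n) :
    graphPairs (F.deleteEdges {pairEnds e}) = graphPairs F \ {e} := by
  ext e'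
  have h := pairEnds_eq_iff e.2 e'
  have h' : s(e'.1.1, e'.1.2) = pairEnds e ↔ e' = e := h
  simp [graphPairs, SimpleGraph.deleteEdges_adj, h']

theorem isEdgeForest_graphPairs_iff {F : SimpleGraph (Fin n)} :
    IsEdgeForest pairEnds (graphPairs F) ↔ F.IsAcyclic := by
  rw [SimpleGraph.isAcyclic_iff_forall_adj_isBridge]
  constructor
  · intro h i j hij
    obtain ⟨e, he, hends⟩ := exists_mem_graphPairs_iff.2 hij
    have := h e he i j hends
    rw [← graphPairs_deleteEdges, edgeConnects_graphPairs_iff, hends] at this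
    exact this
  · intro h e he i j hends
    rw [← graphPairs_deleteEdges, edgeConnects_graphPairs_iff, hends]
    exact h (exists_mem_graphPairs_iff.1 ⟨e, he, hends⟩)

/-- `forestPoly` is the weighted sum of the spanning forests of the complete graph. -/
theorem forestPoly_eq_forestSum (L : Matrix (Fin n) (Fin n) ℝ) (τ : SetPartition n) :
    forestPoly L τ =
      forestSum pairEnds (fun e : NodePair n => L e.1.1 e.1.2) (id : Fin n → Fin n) τ := by
  classical
  rw [forestPoly, forestSum]
  have hcoe : ∀ F : SimpleGraph (Fin n),
      ((Set.toFinite (graphPairs F)).toFinset : Set (NodePair n)) = graphPairs F := fun F =>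
    Set.Finite.coe_toFinset _
  refine Finset.sum_bij (fun F _ => (Set.toFinite (graphPairs F)).toFinset) ?_ ?_ ?_ ?_
  · intro F hF
    simp only [Finset.mem_filter, Finset.mem_univ, true_and] at hF ⊢
    simp only [hcoe, isEdgeForest_graphPairs_iff, edgeConnects_graphPairs_iff]
    exact ⟨⟨hF.1, fun v => ⟨v, SimpleGraph.Reachable.refl _⟩⟩, hF.2⟩
  · intro F _ F' _ h
    have h' : graphPairs F = graphPairs F' := by
      have h : (Set.toFinite (graphPairs F)).toFinset = (Set.toFinite (graphPairs F')).toFinset := h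
      rw [← hcoe F, h, hcoe]
    ext i j
    rw [← exists_mem_graphPairs_iff, ← exists_mem_graphPairs_iff, h']
  · intro S hS
    let F : SimpleGraph (Fin n) :=
      { Adj := fun i j => ∃ e ∈ S, pairEnds e = s(i, j)
        symm := ⟨fun i j ⟨e, he, h⟩ => ⟨e, he, h.trans Sym2.eq_swap⟩⟩
        loopless := ⟨fun i ⟨e, he, h⟩ => by
          have := e.2
          simp only [pairEnds, Sym2.eq_iff] at h
          grind⟩ }
    have hFS : (Set.toFinite (graphPairs F)).toFinset = S := by
      ext e
      simp only [Set.Finite.mem_toFinset, graphPairs, Set.mem_ofPred_eq, F, pairEnds_eq_iff e.2]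
      simp
    refine ⟨F, ?_, hFS⟩
    simp only [Finset.mem_filter, Finset.mem_univ, true_and] at hS ⊢
    rw [← hFS, hcoe] at hS
    simp only [isEdgeForest_graphPairs_iff, edgeConnects_graphPairs_iff] at hS
    exact ⟨hS.1.1, hS.2⟩
  · intro F _
    symm
    refine Finset.prod_bij (fun e _ => e.1) ?_ ?_ ?_ ?_
    · intro e he
      rw [Set.Finite.mem_toFinset] at he
      simp only [Finset.mem_filter, Finset.mem_univ, true_and]
      exact ⟨e.2, he⟩
    · intro e _ e' _ h
      exact Subtype.ext h
    · intro p hp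
      simp only [Finset.mem_filter, Finset.mem_univ, true_and] at hp
      exact ⟨⟨p, hp.1⟩, by simpa [graphPairs] using hp.2, rfl⟩
    · intro e _
      rfl

theorem forestPoly_bot (L : Matrix (Fin n) (Fin n) ℝ) : forestPoly L ⊥ = 1 := by
  classical
  have hbot : ∀ i j : Fin n, SamePart (⊥ : SetPartition n) i j ↔ i = j := by
    intro i j
    simp [SamePart, Finpartition.parts_bot, eq_comm]
  rw [forestPoly, Finset.sum_eq_single (⊥ : SimpleGraph (Fin n))]
  · simp
  · intro F hF hne
    exfalso
    apply hne
    simp only [Finset.mem_filter, Finset.mem_univ, true_and, hbot] at hF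
    ext i j
    simp only [SimpleGraph.bot_adj, iff_false]
    exact fun h => h.ne ((hF.2 i j).1 h.reachable)
  · intro h
    exfalso
    apply h
    simp [hbot, SimpleGraph.isAcyclic_bot]

end CompleteGraph

/-! ### The Laplacian, its inner block and the Schur complement -/

namespace NodedGraph

open Matrix

set_option linter.unusedSectionVars false

variable {V E : Type*} {n : ℕ} (G : NodedGraph V E n) [Fintype V] [Fintype E]

theorem laplacian_eq_sum [DecidableEq V] :
    G.laplacian = ∑ e, G.weight e • symEdgeMatrix (G.ends e) := by
  have hc : ∀ u v, G.conductance u v = ∑ e, if G.ends e = s(u, v) then G.weight e else 0 := by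
    intro u v
    rw [conductance, Finset.sum_filter]
    exact Finset.sum_congr rfl fun e _ => by congr
  ext u v
  simp only [laplacian, hc, Matrix.sum_apply, Matrix.smul_apply, symEdgeMatrix_apply, smul_eq_mul,
    mul_sub, Finset.sum_sub_distrib, mul_ite, mul_one, mul_zero]
  congr 1
  by_cases huv : u = v
  · simp only [huv, if_true, Finset.mul_sum, mul_ite, mul_one, mul_zero]
    exact Finset.sum_comm
  · simp [huv]

theorem laplacian_transpose : G.laplacianᵀ = G.laplacian := by
  classical
  rw [laplacian_eq_sum, transpose_sum]
  refine Finset.sum_congr rfl fun e _ => ?_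
  rw [transpose_smul]
  congr 1
  induction G.ends e with | _ a b =>
  simp [edgeMatrix, transpose_vecMulVec]

theorem laplacian_mulVec_one : G.laplacian *ᵥ 1 = 0 := by
  classical
  rw [laplacian_eq_sum, sum_mulVec]
  exact Finset.sum_eq_zero fun e _ => by rw [smul_mulVec, symEdgeMatrix_mulVec_one, smul_zero]

/-- The vertices are the nodes and the inner vertices. -/
noncomputable def vertexEquiv : Fin n ⊕ G.Inner ≃ V :=
  Equiv.ofBijective (Sum.elim G.node Subtype.val) (by
    constructor
    · refine G.node_injective.sumElim Subtype.val_injective fun i v h => v.2 ⟨i, h⟩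
    · intro v
      by_cases hv : v ∈ Set.range G.node
      · obtain ⟨i, rfl⟩ := hv
        exact ⟨.inl i, rfl⟩
      · exact ⟨.inr ⟨v, hv⟩, rfl⟩)

@[simp] theorem vertexEquiv_inl (i : Fin n) : G.vertexEquiv (.inl i) = G.node i := rfl

@[simp] theorem vertexEquiv_inr (v : G.Inner) : G.vertexEquiv (.inr v) = v.1 := rfl

/-- The block of the Laplacian that is indexed by the inner vertices. -/
noncomputable def innerBlock : Matrix G.Inner G.Inner ℝ :=
  G.laplacian.submatrix Subtype.val Subtype.val

theorem sum_vertices (f : V → ℝ) : ∑ v, f v = ∑ i, f (G.node i) + ∑ v : G.Inner, f v.1 := by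
  rw [← G.vertexEquiv.sum_comp, Fintype.sum_sum_type]
  rfl

/-- The energy is a sum of the terms weight · (x u - x v)² over the edges, with positive weights, so
each difference vanishes. -/
theorem dotProduct_laplacian_mulVec (x : V → ℝ) (he : x ⬝ᵥ G.laplacian *ᵥ x = 0) (e : E) (u v : V)
    (huv : G.ends e = s(u, v)) : x u = x v := by
  classical
  have hq : ∀ a b, x ⬝ᵥ edgeMatrix a b *ᵥ x = (x a - x b) ^ 2 := by
    intro a b
    rw [edgeMatrix_mulVec, dotProduct_smul, dotProduct_sub]
    simp [sq]
  have hnn : ∀ e, 0 ≤ x ⬝ᵥ symEdgeMatrix (G.ends e) *ᵥ x := by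
    intro e
    induction G.ends e with | _ a b =>
    rw [symEdgeMatrix_mk, hq]
    positivity
  rw [laplacian_eq_sum, sum_mulVec, dotProduct_sum] at he
  have h0 := (Finset.sum_eq_zero_iff_of_nonneg fun e _ => by
    rw [smul_mulVec, dotProduct_smul]
    exact mul_nonneg (G.weight_pos e).le (hnn e)).1 he e (Finset.mem_univ e)
  rw [smul_mulVec, dotProduct_smul, smul_eq_mul, mul_eq_zero, huv, symEdgeMatrix_mk, hq] at h0
  have h1 := h0.resolve_left (G.weight_pos e).ne'
  exact sub_eq_zero.1 (pow_eq_zero_iff two_ne_zero |>.1 h1)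

theorem det_innerBlock_ne_zero [DecidableEq V] (hG : G.EveryComponentHasNode) :
    G.innerBlock.det ≠ 0 := by
  intro hdet
  obtain ⟨x, hx, hKx⟩ := exists_mulVec_eq_zero_iff.2 hdet
  classical
  -- A kernel vector of the inner block, extended by zero to the nodes, has zero energy. It is
  -- therefore constant on components, and each component contains a node, where it vanishes.
  let X : V → ℝ := fun v => if h : v ∉ Set.range G.node then x ⟨v, h⟩ else 0
  have hXn : ∀ i, X (G.node i) = 0 := fun i => dif_neg (not_not.2 ⟨i, rfl⟩)
  have hXi : ∀ v : G.Inner, X v.1 = x v := fun v => dif_pos v.2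
  have hΔ : ∀ v : G.Inner, (G.laplacian *ᵥ X) v.1 = 0 := by
    intro v
    rw [mulVec, dotProduct, G.sum_vertices]
    simp only [hXn, hXi, mul_zero, Finset.sum_const_zero, zero_add]
    exact congrFun hKx v
  have hE : X ⬝ᵥ G.laplacian *ᵥ X = 0 := by
    rw [dotProduct, G.sum_vertices]
    simp [hXn, hΔ]
  have hconst : ∀ u v, G.Connects Set.univ u v → X u = X v := by
    intro u v huv
    induction huv with
    | refl => rfl
    | tail _ h ih =>
      obtain ⟨e, -, h⟩ := h
      exact ih.trans (G.dotProduct_laplacian_mulVec X hE e _ _ h)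
  apply hx
  ext v
  obtain ⟨i, hi⟩ := hG v.1
  rw [← hXi, hconst _ _ hi, hXn, Pi.zero_apply]

theorem responseMatrix_eq [DecidableEq V] : G.responseMatrix =
    G.laplacian.submatrix G.node G.node - G.laplacian.submatrix G.node (Subtype.val : G.Inner → V) *
      G.innerBlock⁻¹ * G.laplacian.submatrix (Subtype.val : G.Inner → V) G.node := by
  rw [responseMatrix, innerBlock]
  congr 3
  convert rfl

theorem responseMatrix_transpose : G.responseMatrixᵀ = G.responseMatrix := by
  classical
  rw [responseMatrix_eq, transpose_sub, transpose_mul, transpose_mul, transpose_nonsing_inv,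
    innerBlock]
  simp only [transpose_submatrix, laplacian_transpose, Matrix.mul_assoc]

theorem responseMatrix_mulVec_one (hG : G.EveryComponentHasNode) :
    G.responseMatrix *ᵥ 1 = 0 := by
  classical
  have hK : IsUnit G.innerBlock.det := isUnit_iff_ne_zero.2 (G.det_innerBlock_ne_zero hG)
  have hsum : ∀ u, ∑ i, G.laplacian u (G.node i) + ∑ v : G.Inner, G.laplacian u v.1 = 0 := by
    intro u
    have := congrFun G.laplacian_mulVec_one u
    rw [mulVec, dotProduct, G.sum_vertices] at this
    simpa using this
  have hF : G.laplacian.submatrix G.node G.node *ᵥ 1 =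
      -(G.laplacian.submatrix G.node (Subtype.val : G.Inner → V) *ᵥ 1) := by
    ext i
    rw [Pi.neg_apply, eq_neg_iff_add_eq_zero]
    simpa [mulVec, dotProduct] using hsum (G.node i)
  have hH : G.laplacian.submatrix (Subtype.val : G.Inner → V) G.node *ᵥ 1 =
      -(G.innerBlock *ᵥ 1) := by
    ext v
    rw [Pi.neg_apply, eq_neg_iff_add_eq_zero]
    simpa [mulVec, dotProduct, innerBlock] using hsum v.1
  rw [responseMatrix_eq, sub_mulVec, ← mulVec_mulVec, ← mulVec_mulVec, hH, hF, mulVec_neg,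
    mulVec_mulVec, nonsing_inv_mul _ hK, one_mulVec, mulVec_neg, sub_self]

/-- `T` changes only the node block of the Laplacian, so the inner block is untouched and the Schur
complement is shifted by `T`. -/
theorem det_laplacian_add_compress [DecidableEq V] (hG : G.EveryComponentHasNode)
    (T : Matrix (Fin n) (Fin n) ℝ) :
    (G.laplacian + compress G.node T).det = G.innerBlock.det * (G.responseMatrix + T).det := by
  have hK : IsUnit G.innerBlock.det := isUnit_iff_ne_zero.2 (G.det_innerBlock_ne_zero hG)
  let _ := invertibleOfIsUnitDet G.innerBlock hK
  have hni : ∀ (v : G.Inner) i, G.node i ≠ v.1 := fun v i h => v.2 ⟨i, h⟩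
  have hblock : (G.laplacian + compress G.node T).submatrix G.vertexEquiv G.vertexEquiv =
      fromBlocks (G.laplacian.submatrix G.node G.node + T)
        (G.laplacian.submatrix G.node (Subtype.val : G.Inner → V))
        (G.laplacian.submatrix (Subtype.val : G.Inner → V) G.node) G.innerBlock := by
    ext (i | u) (j | v)
    · simp [compress_apply, G.node_injective.eq_iff, ite_and]
    · simp [compress_apply, hni]
    · simp [compress_apply, hni]
    · simp [compress_apply, hni, innerBlock]
  rw [← det_submatrix_equiv_self G.vertexEquiv, hblock, det_fromBlocks₂₂, invOf_eq_nonsing_inv,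
    responseMatrix_eq]
  congr 2
  abel

theorem groveSumOfType_eq_forestSum [DecidableEq V] (τ : SetPartition n) :
    G.groveSumOfType τ = forestSum G.ends G.weight G.node τ := by
  rw [groveSumOfType, forestSum]
  refine Finset.sum_congr ?_ fun _ _ => rfl
  ext F
  simp only [Finset.mem_filter]
  rfl

/-- The grove sums and the forest polynomials of the response matrix agree, up to a constant
factor, when tested against Gram determinants. -/
theorem sum_groveSumOfType_mul_gramDet [DecidableEq V] (hG : G.EveryComponentHasNode)
    (T : Matrix (Fin n) (Fin n) ℝ) :
    ∑ τ, G.groveSumOfType τ * gramDet T τ.parts =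
      G.innerBlock.det * ∑ τ, forestPoly G.L τ * gramDet T τ.parts := by
  simp only [groveSumOfType_eq_forestSum, forestPoly_eq_forestSum]
  rw [← det_add_compress_node, ← det_add_compress_node, ← laplacian_eq_sum,
    G.det_laplacian_add_compress hG, compress_id, L,
    ← eq_sum_symEdgeMatrix _ G.responseMatrix_transpose (G.responseMatrix_mulVec_one hG)]

end NodedGraph

/-! ### The reduction as a linear projection onto planar partitions -/

section Projection

variable {n : ℕ} {P : PlanarPartition n → SetPartition n → ℤ}

/-- A linear functional that is unchanged by Rule 1 factors through the reduction. -/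
theorem IsRuleInvariant.eq_sum {φ : SetPartition n → ℝ} (hφ : IsRuleInvariant φ)
    (hP : ∀ τ, Relation.ReflTransGen Rule1Step (Finsupp.single τ 1)
      (planarComb fun σ => P σ τ)) (τ : SetPartition n) :
    φ τ = ∑ σ, (P σ τ : ℝ) * φ σ.1 := by
  have h := hφ.copies (reflTransGen_copies_of_step (hP τ))
  rw [linearCombination_planarComb] at h
  simpa using h.symm

/-- By invariance, testing `z` is the same as testing its image under the reduction, and that image
is supported on planar partitions, where the Gram functionals separate. -/
theorem sum_projection_eq_zero
    (hP : ∀ τ, Relation.ReflTransGen Rule1Step (Finsupp.single τ 1)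
      (planarComb fun σ => P σ τ)) (z : SetPartition n → ℝ)
    (hz : ∀ T, ∑ τ : SetPartition n, z τ * gramDet T τ.parts = 0) (σ : PlanarPartition n) :
    ∑ τ, (P σ τ : ℝ) * z τ = 0 := by
  refine congrFun (eq_zero_of_sum_gramDet_eq_zero (fun σ => ∑ τ, (P σ τ : ℝ) * z τ) fun T => ?_) σ
  rw [← hz T, Finset.sum_congr rfl fun τ _ =>
    congrArg (z τ * ·) ((isRuleInvariant_gramDet T).eq_sum hP τ)]
  simp only [Finset.sum_mul, Finset.mul_sum]
  rw [Finset.sum_comm]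
  exact Finset.sum_congr rfl fun τ _ => Finset.sum_congr rfl fun σ _ => by ring

theorem isPlanarPartition_bot : IsPlanarPartition (⊥ : SetPartition n) := by
  rintro p hp q hq - ⟨a, b, c, d, hab, hbc, -, hap, hcp, -⟩
  rw [Finpartition.parts_bot, Finset.mem_map] at hp
  obtain ⟨k, -, rfl⟩ := hp
  simp at hap hcp
  exact absurd (hab.trans hbc) (by rw [hap, hcp]; exact lt_irrefl _)

theorem projection_bot
    (hP : ∀ τ, Relation.ReflTransGen Rule1Step (Finsupp.single τ 1)
      (planarComb fun σ => P σ τ)) (τ : SetPartition n) [Decidable (τ = ⊥)] :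
    (P ⟨⊥, isPlanarPartition_bot⟩ τ : ℝ) = if τ = ⊥ then 1 else 0 := by
  classical
  have h := isRuleInvariant_bot.eq_sum hP τ
  rw [Finset.sum_eq_single (⟨⊥, isPlanarPartition_bot⟩ : PlanarPartition n)] at h
  · simp only [if_true, mul_one] at h
    rw [← h]
    congr
  · intro σ _ hne
    rw [if_neg fun h => hne (Subtype.ext h), mul_zero]
  · simp

/-- A planar partition is already a result of the reduction in zero steps, and results are unique.
-/
theorem projection_planar
    (hP : ∀ τ, Relation.ReflTransGen Rule1Step (Finsupp.single τ 1)
      (planarComb fun σ => P σ τ)) (σ ρ : PlanarPartition n) [Decidable (σ = ρ)] :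
    P σ ρ.1 = if σ = ρ then 1 else 0 := by
  classical
  have h : planarComb (fun σ : PlanarPartition n => if σ = ρ then 1 else 0) =
      Finsupp.single ρ.1 1 := by
    rw [planarComb, Finset.sum_eq_single ρ]
    · simp
    · intro σ _ hne
      simp [hne]
    · simp
  rw [congrFun (planarComb_unique (reflTransGen_copies_of_step (hP ρ.1))
    (c' := fun σ : PlanarPartition n => if σ = ρ then 1 else 0) (by rw [h])) σ]
  congr

end Projection

/-! ### Grove probabilities in terms of the response matrix -/

namespace NodedGraph

set_option linter.unusedSectionVars false

variable {V E : Type*} {n : ℕ} (G : NodedGraph V E n) [Fintype V] [Fintype E]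
  {P : PlanarPartition n → SetPartition n → ℤ}

theorem sum_projection_groveSumOfType [DecidableEq V] (hG : G.EveryComponentHasNode)
    (hP : ∀ τ, Relation.ReflTransGen Rule1Step (Finsupp.single τ 1)
      (planarComb fun σ => P σ τ)) (σ : PlanarPartition n) :
    ∑ τ, (P σ τ : ℝ) * G.groveSumOfType τ =
      G.innerBlock.det * ∑ τ, (P σ τ : ℝ) * forestPoly G.L τ := by
  have h := sum_projection_eq_zero hP
    (fun τ => G.groveSumOfType τ - G.innerBlock.det * forestPoly G.L τ) (fun T => by
      have := G.sum_groveSumOfType_mul_gramDet hG T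
      simp only [sub_mul, Finset.sum_sub_distrib, this, Finset.mul_sum, mul_assoc, sub_self]) σ
  rw [Finset.mul_sum, ← sub_eq_zero, ← h, ← Finset.sum_sub_distrib]
  exact Finset.sum_congr rfl fun τ _ => by ring

/-- The groves that connect no two nodes are counted by the inner block of the Laplacian. -/
theorem groveSumOfType_bot [DecidableEq V] (hG : G.EveryComponentHasNode)
    (hP : ∀ τ, Relation.ReflTransGen Rule1Step (Finsupp.single τ 1)
      (planarComb fun σ => P σ τ)) : G.groveSumOfType ⊥ = G.innerBlock.det := by
  classical
  -- At `σ = ⊥` the coefficients are 1 at `⊥` and 0 elsewhere, and the forest polynomial of `⊥` is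
  -- 1.
  have h := G.sum_projection_groveSumOfType hG hP ⟨⊥, isPlanarPartition_bot⟩
  simp only [projection_bot hP, ite_mul, one_mul, zero_mul, Finset.sum_ite_eq', Finset.mem_univ,
    if_true, forestPoly_bot, mul_one] at h
  exact h

theorem groveSumOfType_le_groveSum (τ : SetPartition n) : G.groveSumOfType τ ≤ G.groveSum := by
  classical
  rw [groveSumOfType, groveSum]
  refine Finset.sum_le_sum_of_subset_of_nonneg (fun F hF => ?_) fun F _ _ =>
    Finset.prod_nonneg fun e _ => (G.weight_pos e).le
  obtain ⟨h1, h2⟩ := Finset.mem_filter.1 hF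
  exact Finset.mem_filter.2 ⟨h1, h2.1⟩

theorem groveSumOfType_nonneg (τ : SetPartition n) : 0 ≤ G.groveSumOfType τ :=
  Finset.sum_nonneg fun _ _ => Finset.prod_nonneg fun e _ => (G.weight_pos e).le

/-- The identity between grove probabilities and response matrix entries for arbitrary graphs. -/
theorem sum_projection_pr (hG : G.EveryComponentHasNode)
    (hP : ∀ τ, Relation.ReflTransGen Rule1Step (Finsupp.single τ 1)
      (planarComb fun σ => P σ τ)) (σ : PlanarPartition n) :
    ∑ τ, (P σ τ : ℝ) * (G.Pr τ / G.Pr ⊥) = ∑ τ, (P σ τ : ℝ) * forestPoly G.L τ := by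
  classical
  have hbot := G.groveSumOfType_bot hG hP
  have hdet := G.det_innerBlock_ne_zero hG
  have hpos : 0 < G.groveSumOfType ⊥ :=
    lt_of_le_of_ne (G.groveSumOfType_nonneg ⊥) (hbot ▸ hdet).symm
  have hZ : G.groveSum ≠ 0 := (hpos.trans_le (G.groveSumOfType_le_groveSum ⊥)).ne'
  have h := G.sum_projection_groveSumOfType hG hP σ
  simp only [Pr, div_div_div_cancel_right₀ hZ, hbot]
  rw [← mul_right_inj' hdet, ← h, Finset.mul_sum]
  refine Finset.sum_congr rfl fun τ _ => ?_
  field_simp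

end NodedGraph

/-! ## Curves in the disk with interleaved ends meet -/

section Disk

open Complex Real

/-- Uniqueness of lifts through the covering `exp` of the punctured plane. -/
theorem eq_of_exp_eq {φ ψ : ℝ → ℂ} (hφ : Continuous φ) (hψ : Continuous ψ)
    (h : ∀ s, exp (φ s) = exp (ψ s)) (h0 : φ 0 = ψ 0) (s : ℝ) : φ s = ψ s := by
  have huniq := isCoveringMapOn_exp.existsUnique_continuousMap_lifts
    (⟨fun s => exp (φ s), by fun_prop⟩ : C(ℝ, ℂ)) (a₀ := 0) (e₀ := φ 0) rfl
    (fun s => by simp)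
  have := huniq.unique (y₁ := ⟨φ, hφ⟩) (y₂ := ⟨ψ, hψ⟩) ⟨rfl, rfl⟩
    ⟨h0.symm, funext fun s => (h s).symm⟩
  exact congrArg (fun f : C(ℝ, ℂ) => f s) this

/-- Along a curve in the unit disk, the logarithm of the distance vector from a boundary point is
given by the principal branch. -/
theorem sub_eq_log_sub_log {φ p : ℝ → ℂ} {w κ : ℂ} (hφ : Continuous φ) (hp : Continuous p)
    (hw : ‖w‖ = 1) (hp1 : ∀ s, ‖p s‖ ≤ 1) (hpw : ∀ s, p s ≠ w)
    (h : ∀ s, exp (φ s) = κ * (p s - w)) :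
    φ 1 - φ 0 = log (1 - p 1 * (starRingEnd ℂ) w) - log (1 - p 0 * (starRingEnd ℂ) w) := by
  have hww : w * (starRingEnd ℂ) w = 1 := by
    rw [mul_conj, normSq_eq_norm_sq, hw]
    simp
  have hne : ∀ s, p s * (starRingEnd ℂ) w ≠ 1 := by
    intro s hs
    apply hpw s
    calc p s = p s * (starRingEnd ℂ) w * w := by rw [mul_assoc, mul_comm _ w, hww, mul_one]
      _ = w := by rw [hs, one_mul]
  -- A point of the closed unit disk other than 1 has real part below 1, so the logarithm is taken
  -- in the right half plane.
  have hslit : ∀ s, 1 - p s * (starRingEnd ℂ) w ∈ slitPlane := by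
    intro s
    have hn : ‖p s * (starRingEnd ℂ) w‖ ≤ 1 := by
      rw [norm_mul, RCLike.norm_conj, hw, mul_one]
      exact hp1 s
    set z := p s * (starRingEnd ℂ) w with hz
    have hre : z.re ≤ 1 := (re_le_norm z).trans hn
    rcases hre.lt_or_eq with hlt | heq
    · left
      simpa using hlt
    · exfalso
      apply hne s
      have hsq : z.re ^ 2 + z.im ^ 2 ≤ 1 := by
        have h1 : normSq z ≤ 1 := by
          rw [normSq_eq_norm_sq]
          nlinarith [norm_nonneg z]
        rw [normSq_apply] at h1
        nlinarith
      rw [heq] at hsq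
      have him : z.im = 0 := by nlinarith
      exact Complex.ext heq him
  have hψ : Continuous fun s => φ 0 - log (1 - p 0 * (starRingEnd ℂ) w) +
      log (1 - p s * (starRingEnd ℂ) w) :=
    continuous_const.add (Continuous.clog (by fun_prop) hslit)
  have hkey := eq_of_exp_eq hφ hψ (fun s => by
    have h0 := slitPlane_ne_zero (hslit 0)
    have hs := slitPlane_ne_zero (hslit s)
    have e : ∀ s, p s - w = -w * (1 - p s * (starRingEnd ℂ) w) := fun s => by
      linear_combination (-p s) * hww
    rw [Complex.exp_add, Complex.exp_sub, Complex.exp_log h0, Complex.exp_log hs, h, h, e, e]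
    rw [← mul_assoc, ← mul_assoc, mul_div_cancel_right₀ _ h0]) (by ring) 1
  rw [hkey]
  ring

theorem log_one_sub_exp_im {θ : ℝ} (h0 : 0 < θ) (h1 : θ < 2 * π) :
    (log (1 - exp (θ * I))).im = (θ - π) / 2 := by
  rw [log_im]
  have hsin : 0 < Real.sin (θ / 2) := Real.sin_pos_of_pos_of_lt_pi (by linarith) (by linarith)
  have : 1 - exp (θ * I) = ((2 * Real.sin (θ / 2) : ℝ) : ℂ) *
      (Complex.cos ((θ - π) / 2 : ℝ) + Complex.sin ((θ - π) / 2 : ℝ) * I) := by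
    have hc : Real.cos ((θ - π) / 2) = Real.sin (θ / 2) := by
      rw [sub_div, Real.cos_sub_pi_div_two]
    have hs : Real.sin ((θ - π) / 2) = - Real.cos (θ / 2) := by
      rw [sub_div, Real.sin_sub_pi_div_two]
    rw [← ofReal_cos, ← ofReal_sin, hc, hs, exp_mul_I, ← ofReal_cos, ← ofReal_sin]
    have e1 : Real.cos θ = 1 - 2 * Real.sin (θ / 2) ^ 2 := by
      have := Real.cos_two_mul (θ / 2)
      rw [mul_div_cancel₀ θ two_ne_zero] at this
      rw [this, Real.cos_sq']
      ring
    have e2 : Real.sin θ = 2 * Real.sin (θ / 2) * Real.cos (θ / 2) := by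
      have := Real.sin_two_mul (θ / 2)
      rwa [mul_div_cancel₀ θ two_ne_zero] at this
    rw [e1, e2]
    push_cast
    ring
  rw [this, arg_mul_cos_add_sin_mul_I (by linarith) ⟨by linarith, by linarith⟩]

theorem exp_mul_conj_exp (x y : ℝ) :
    exp (x * I) * (starRingEnd ℂ) (exp (y * I)) = exp ((x - y : ℝ) * I) := by
  rw [← exp_conj, ← Complex.exp_add]
  congr 1
  simp
  ring

theorem log_one_sub_im_of_lt {x y : ℝ} (h : x < y) (h' : y < x + 2 * π) :
    (log (1 - exp (y * I) * (starRingEnd ℂ) (exp (x * I)))).im = (y - x - π) / 2 := by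
  rw [exp_mul_conj_exp, log_one_sub_exp_im (by linarith) (by linarith)]

theorem log_one_sub_im_of_gt {x y : ℝ} (h : x < y) (h' : y < x + 2 * π) :
    (log (1 - exp (x * I) * (starRingEnd ℂ) (exp (y * I)))).im = -(y - x - π) / 2 := by
  -- A full turn brings the angle into (0, 2π), where `log_one_sub_exp_im` applies.
  have e : exp ((x - y : ℝ) * I) = exp ((x - y + 2 * π : ℝ) * I) := by
    push_cast
    rw [add_mul, Complex.exp_add, exp_two_pi_mul_I, mul_one]
  rw [exp_mul_conj_exp, e, log_one_sub_exp_im (by linarith) (by linarith)]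
  ring

/-- If the curves did not meet, f(s) - g(t) would have a continuous logarithm on the plane. On each
side of the unit square one curve rests at a boundary point, so the change of argument is an
explicit function of the angles. The four changes around the square sum to -2π instead of 0. -/
theorem exists_eq_of_interleaved {α β γ δ : ℝ} (hαβ : α < β) (hβγ : β < γ) (hγδ : γ < δ)
    (hδα : δ < α + 2 * π) {f g : ℝ → ℂ} (hf : Continuous f) (hg : Continuous g)
    (hf1 : ∀ s, ‖f s‖ ≤ 1) (hg1 : ∀ t, ‖g t‖ ≤ 1) (f0 : f 0 = exp (α * I)) (f1 : f 1 = exp (γ * I))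
    (g0 : g 0 = exp (β * I)) (g1 : g 1 = exp (δ * I)) : ∃ s t, f s = g t := by
  by_contra! hne
  have hnorm : ∀ x : ℝ, ‖exp (x * I)‖ = 1 := norm_exp_ofReal_mul_I
  obtain ⟨Φ, ⟨-, hΦ⟩, -⟩ := isCoveringMapOn_exp.existsUnique_continuousMap_lifts
    (⟨fun x => f x.1 - g x.2, by fun_prop⟩ : C(ℝ × ℝ, ℂ)) (a₀ := (0, 0))
    (e₀ := log (f 0 - g 0)) (Complex.exp_log (sub_ne_zero.2 (hne 0 0)))
    (fun x => sub_ne_zero.2 (hne x.1 x.2))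
  have hexp : ∀ s t, exp (Φ (s, t)) = f s - g t := fun s t => congrFun hΦ (s, t)
  have hb := sub_eq_log_sub_log (φ := fun s => Φ (s, 0)) (p := f) (w := g 0) (κ := 1)
    (by fun_prop) hf (by rw [g0, hnorm]) hf1 (fun s => hne s 0) (fun s => by rw [hexp, one_mul])
  have ht := sub_eq_log_sub_log (φ := fun s => Φ (s, 1)) (p := f) (w := g 1) (κ := 1)
    (by fun_prop) hf (by rw [g1, hnorm]) hf1 (fun s => hne s 1) (fun s => by rw [hexp, one_mul])
  have hl := sub_eq_log_sub_log (φ := fun t => Φ (0, t)) (p := g) (w := f 0) (κ := -1)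
    (by fun_prop) hg (by rw [f0, hnorm]) hg1 (fun t => (hne 0 t).symm)
    (fun t => by rw [hexp]; ring)
  have hr := sub_eq_log_sub_log (φ := fun t => Φ (1, t)) (p := g) (w := f 1) (κ := -1)
    (by fun_prop) hg (by rw [f1, hnorm]) hg1 (fun t => (hne 1 t).symm)
    (fun t => by rw [hexp]; ring)
  have hb' := congrArg Complex.im hb
  have ht' := congrArg Complex.im ht
  have hl' := congrArg Complex.im hl
  have hr' := congrArg Complex.im hr
  simp only [sub_im, f0, f1, g0, g1] at hb' ht' hl' hr'
  rw [log_one_sub_im_of_lt hβγ (by linarith), log_one_sub_im_of_gt hαβ (by linarith)] at hb'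
  rw [log_one_sub_im_of_gt hγδ (by linarith),
    log_one_sub_im_of_gt (hαβ.trans (hβγ.trans hγδ)) (by linarith)] at ht'
  rw [log_one_sub_im_of_lt (hαβ.trans (hβγ.trans hγδ)) (by linarith),
    log_one_sub_im_of_lt hαβ (by linarith)] at hl'
  rw [log_one_sub_im_of_lt hγδ (by linarith), log_one_sub_im_of_gt hβγ (by linarith)] at hr'
  linarith [Real.pi_pos]

/-- Two subsets of the disk which join interleaved pairs of boundary points meet. -/
theorem not_disjoint_of_joinedIn {α β γ δ : ℝ} (hαβ : α < β) (hβγ : β < γ) (hγδ : γ < δ)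
    (hδα : δ < α + 2 * π) {S T : Set ℂ} (hS : ∀ z ∈ S, ‖z‖ ≤ 1) (hT : ∀ z ∈ T, ‖z‖ ≤ 1)
    (hac : JoinedIn S (exp (α * I)) (exp (γ * I)))
    (hbd : JoinedIn T (exp (β * I)) (exp (δ * I))) : ¬ Disjoint S T := by
  intro hdisj
  obtain ⟨f, hf⟩ := hac
  obtain ⟨g, hg⟩ := hbd
  have hfS : ∀ s, f.extend s ∈ S := fun s => hf _
  have hgT : ∀ t, g.extend t ∈ T := fun t => hg _
  obtain ⟨s, t, hst⟩ := exists_eq_of_interleaved hαβ hβγ hγδ hδα f.continuous_extend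
    g.continuous_extend (fun s => hS _ (hfS s)) (fun t => hT _ (hgT t)) f.extend_zero f.extend_one
    g.extend_zero g.extend_one
  exact Set.disjoint_left.1 hdisj (hfS s) (hst ▸ hgT t)

end Disk

/-! ### Components of subgraphs in a disk drawing -/

section DrawingPlanarity

variable {V E : Type*} {n : ℕ} {G : NodedGraph V E n} (D : DiskDrawing G)

/-- The part of the drawing that is occupied by the component of `u` in the subgraph `F`. -/
def DiskDrawing.component (F : Set E) (u : V) : Set ℂ :=
  {z | ∃ v, EdgeConnects G.ends F u v ∧
    (z = D.pos v ∨ ∃ e ∈ F, v ∈ G.ends e ∧ ∃ t ∈ Set.Icc (0 : ℝ) 1, z = D.arc e t)}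

theorem DiskDrawing.norm_le_of_mem_component {F : Set E} {u : V} {z : ℂ}
    (hz : z ∈ D.component F u) : ‖z‖ ≤ 1 := by
  obtain ⟨v, -, rfl | ⟨e, -, -, t, ht, rfl⟩⟩ := hz
  · exact D.pos_mem_disk v
  · exact D.arc_mem_disk e t ht

theorem DiskDrawing.joinedIn_arc {e : E} {x y : V} (h : G.ends e = s(x, y)) :
    JoinedIn (D.arc e '' Set.Icc 0 1) (D.pos x) (D.pos y) := by
  have hpath : IsPathConnected (D.arc e '' Set.Icc 0 1) :=
    ((convex_Icc (0 : ℝ) 1).isPathConnected ⟨0, by simp⟩).image' (D.arc_continuousOn e)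
  have hends := D.arc_ends e
  rw [h, Sym2.map_mk, Sym2.eq_iff] at hends
  have h0 : D.arc e 0 ∈ D.arc e '' Set.Icc 0 1 := ⟨0, by simp, rfl⟩
  have h1 : D.arc e 1 ∈ D.arc e '' Set.Icc 0 1 := ⟨1, by simp, rfl⟩
  rcases hends with ⟨hx, hy⟩ | ⟨hy, hx⟩
  · rw [← hx, ← hy]
    exact hpath.joinedIn _ h0 _ h1
  · rw [← hx, ← hy]
    exact hpath.joinedIn _ h1 _ h0

theorem DiskDrawing.joinedIn_component {F : Set E} {u v : V} (h : EdgeConnects G.ends F u v) :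
    JoinedIn (D.component F u) (D.pos u) (D.pos v) := by
  induction h with
  | refl => exact JoinedIn.refl ⟨u, .refl F u, .inl rfl⟩
  | @tail x y hux hxy ih =>
    obtain ⟨e, he, hends⟩ := hxy
    refine ih.trans ((D.joinedIn_arc hends).mono ?_)
    rintro _ ⟨t, ht, rfl⟩
    exact ⟨x, hux, .inr ⟨e, he, by simp [hends], t, ht, rfl⟩⟩

/-- A point of the drawing of a component is the position of a vertex or lies in the interior of
an edge curve. -/
theorem DiskDrawing.mem_component_cases {F : Set E} {u : V} {z : ℂ} (hz : z ∈ D.component F u) :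
    (∃ v, EdgeConnects G.ends F u v ∧ z = D.pos v) ∨
      ∃ e ∈ F, ∃ v ∈ G.ends e, EdgeConnects G.ends F u v ∧
        ∃ t ∈ Set.Ioo (0 : ℝ) 1, z = D.arc e t := by
  obtain ⟨v, huv, rfl | ⟨e, he, hv, t, ht, rfl⟩⟩ := hz
  · exact .inl ⟨v, huv, rfl⟩
  · obtain ⟨w, hw⟩ := hv
    have hends := D.arc_ends e
    have huw : EdgeConnects G.ends F u w := huv.trans (.of_mem he hw)
    rw [hw, Sym2.map_mk, Sym2.eq_iff] at hends
    rcases ht.1.eq_or_lt with rfl | h0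
    · rcases hends with ⟨hx, -⟩ | ⟨hx, -⟩
      · exact .inl ⟨v, huv, hx⟩
      · exact .inl ⟨w, huw, hx⟩
    · rcases ht.2.eq_or_lt with rfl | h1
      · rcases hends with ⟨-, hx⟩ | ⟨-, hx⟩
        · exact .inl ⟨w, huw, hx⟩
        · exact .inl ⟨v, huv, hx⟩
      · exact .inr ⟨e, he, v, hw ▸ Sym2.mem_mk_left v w, huv, t, ⟨h0, h1⟩, rfl⟩

/-- A common point is either a vertex of both components or interior to one edge of both, because
edge curves avoid vertices and each other between their ends. -/
theorem DiskDrawing.disjoint_component {F : Set E} {u v : V} (h : ¬ EdgeConnects G.ends F u v) :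
    Disjoint (D.component F u) (D.component F v) := by
  rw [Set.disjoint_left]
  intro z hz hz'
  rcases D.mem_component_cases hz with ⟨x, hx, rfl⟩ | ⟨e, he, x, hxe, hx, t, ht, rfl⟩
  · rcases D.mem_component_cases hz' with ⟨y, hy, hxy⟩ | ⟨e', -, y, -, hy, t, ht, hxy⟩
    · rw [D.pos_injective hxy] at hx
      exact h (hx.trans hy.symm)
    · exact D.arc_ne_pos e' t ht x hxy.symm
  · rcases D.mem_component_cases hz' with ⟨y, hy, hxy⟩ | ⟨e', he', y, hye, hy, t', ht', hxy⟩
    · exact D.arc_ne_pos e t ht y hxy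
    · have hee : e = e' := by
        by_contra hne
        exact D.arc_ne_arc e e' hne t ht t' ht' hxy
      subst hee
      obtain ⟨w, hw⟩ := hxe
      have hxy' : EdgeConnects G.ends F x y := by
        rw [hw, Sym2.mem_iff] at hye
        rcases hye with rfl | rfl
        · exact .refl F y
        · exact .of_mem he hw
      exact h (hx.trans (hxy'.trans hy.symm))

/-- In a circular planar graph, the components of a subgraph partition the nodes in a planar
way. -/
theorem isPlanarPartition_of_hasType (hG : IsCircularPlanar G) {F : Set E} {τ : SetPartition n}
    (hF : G.HasType F τ) : IsPlanarPartition τ := by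
  obtain ⟨D⟩ := hG
  rintro p hp q hq hpq ⟨a, b, c, d, hab, hbc, hcd, hap, hcp, hbq, hdq⟩
  have hac : EdgeConnects G.ends F (G.node a) (G.node c) := (hF a c).2 ⟨p, hp, hap, hcp⟩
  have hbd : EdgeConnects G.ends F (G.node b) (G.node d) := (hF b d).2 ⟨q, hq, hbq, hdq⟩
  have hnab : ¬ EdgeConnects G.ends F (G.node a) (G.node b) := by
    intro h
    obtain ⟨r, hr, har, hbr⟩ := (hF a b).1 h
    exact hpq ((τ.eq_of_mem_parts hp hr hap har).trans (τ.eq_of_mem_parts hr hq hbr hbq))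
  have jac := D.joinedIn_component hac
  have jbd := D.joinedIn_component hbd
  rw [D.pos_node, D.pos_node] at jac jbd
  exact not_disjoint_of_joinedIn (D.angle_strictMono hab) (D.angle_strictMono hbc)
    (D.angle_strictMono hcd) (D.angle_lt d a) (fun z => D.norm_le_of_mem_component)
    (fun z => D.norm_le_of_mem_component) jac jbd (D.disjoint_component hnab)

theorem NodedGraph.pr_eq_zero_of_not_planar [Fintype V] [Fintype E] (hG : IsCircularPlanar G)
    {τ : SetPartition n} (hτ : ¬ IsPlanarPartition τ) : G.Pr τ = 0 := by
  classical
  rw [NodedGraph.Pr, NodedGraph.groveSumOfType, Finset.sum_eq_zero, zero_div]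
  intro F hF
  exact absurd (isPlanarPartition_of_hasType hG (Finset.mem_filter.1 hF).2.2) hτ

end DrawingPlanarity

theorem theorem1p2 (n : ℕ) :
    ∃ P : PlanarPartition n → SetPartition n → ℤ,
      -- every partition can be transformed into a linear combination of planar partitions
      (∀ τ : SetPartition n,
        Relation.ReflTransGen Rule1Step (Finsupp.single τ 1) (planarComb (fun σ => P σ τ))) ∧
      -- whatever choices are made, no other combination of planar partitions can be reached
      (∀ (τ : SetPartition n) (y : PartitionComb n),
        Relation.ReflTransGen Rule1StepCopies (Finsupp.single τ 1) y →
        (∀ ρ ∈ y.support, IsPlanarPartition ρ) →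
        y = planarComb (fun σ => P σ τ)) ∧
      -- circular planar graphs
      (∀ (V : Type u) (E : Type v) [Fintype V] [Fintype E] (G : NodedGraph V E n),
        G.EveryComponentHasNode → IsCircularPlanar G → ∀ σ : PlanarPartition n,
          G.Pr σ.1 / G.Pr ⊥ = ∑ τ : SetPartition n, (P σ τ : ℝ) * forestPoly G.L τ) ∧
      -- arbitrary graphs
      (∀ (V : Type u) (E : Type v) [Fintype V] [Fintype E] (G : NodedGraph V E n),
        G.EveryComponentHasNode → ∀ σ : PlanarPartition n,
          ∑ τ : SetPartition n, (P σ τ : ℝ) * (G.Pr τ / G.Pr ⊥) =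
            ∑ τ : SetPartition n, (P σ τ : ℝ) * forestPoly G.L τ) := by
  classical
  choose c hc using fun τ : SetPartition n => exists_reduction (Finsupp.single τ 1)
  have hP : ∀ τ, Relation.ReflTransGen Rule1Step (Finsupp.single τ 1)
      (planarComb fun σ => c τ σ) := hc
  refine ⟨fun σ τ => c τ σ, hP, fun τ y hy hplanar => ?_, fun V E _ _ G hG hcirc σ => ?_,
    fun V E _ _ G hG σ => G.sum_projection_pr hG hP σ⟩
  · rw [eq_planarComb hplanar] at hy ⊢
    rw [planarComb_unique hy (reflTransGen_copies_of_step (hP τ))]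
  -- In the sum of P σ τ · Pr τ / Pr ⊥, the other planar partitions have coefficient zero and the
  -- nonplanar ones have probability zero.
  · rw [← G.sum_projection_pr hG hP σ, Finset.sum_eq_single σ.1]
    · rw [projection_planar hP σ σ, if_pos rfl, Int.cast_one, one_mul]
    · intro τ _ hne
      by_cases hτ : IsPlanarPartition τ
      · rw [projection_planar hP σ ⟨τ, hτ⟩, if_neg fun h => hne (congrArg Subtype.val h).symm,
          Int.cast_zero, zero_mul]
      · rw [G.pr_eq_zero_of_not_planar hcirc hτ, zero_div, mul_zero]
    · simp
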